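/- **Conventions.** A text $T$ of length $n$ is a sequence of $n$ natural numbers (characters) $T[1],\dots,T[n]$, and $T_{p..n}$ is its suffix starting at position $p$. Its suffix array $A[1,n]$ lists the positions $1,\dots,n$ in the lexicographic order of the suffixes starting there. Its LCP-array $H[1,n]$ is given by $H[1]=0$ and, for $1<i\le n$, $H[i]=$ the length of the longest common prefix of $T_{A[i-1]..n}$ and $T_{A[i]..n}$. Algorithms run on a word-RAM with word width $w(n)$ for texts of length $n$, where $n<2^{w(n)}$; arithmetic, bitwise, shift and comparison operations on $w$-bit words and accesses to memory words cost one step each. A data structure consists of a bit string stored for the text, packed into words, together with fixed query programs, which also know $n$ and $w(n)$; its space is the length of the bit string. Let $\mathcal K$ be a set of texts. A *compressed suffix array* for $\mathcal K$ with access time $t_A$ is a data structure that for every text $T\in\mathcal K$ of length $n$ computes any given entry $A[i]$ $(1\le i\le n)$ of the suffix array in at most $t_A(n)$ steps and retrieves any given character $T[j]$ $(1\le j\le n)$ in $O(t_A(n))$ steps. **Statement.** Let a compressed suffix array for $\mathcal K$ with access time $t_A(n)=O(\log^{\epsilon}n)$ be given, where $\epsilon>0$ is a constant, and let $0<\delta\le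 1$ be an arbitrary constant. Then the LCP-arrays of the texts in $\mathcal K$ can be stored in $o(n)$ bits in addition to the compressed suffix array, such that every entry $H[i]$ $(1\le i\le n)$ can be accessed in $O(\log^{\epsilon+\delta}n)$ steps. That is, there are a bit string of length $o(n)$ for each text $T\in\mathcal K$ of length $n$ and one query program which, given $i$, outputs $H[i]$ within that time; the program has access to the text and to the suffix array only by calling the two operations of the compressed suffix array, whose running time is included. The $o(n)$ and $O(\cdot)$ bounds hold uniformly over all texts of length $n$ in $\mathcal K$ and all $i$. -/

import Mathlib

open Filter Asymptotics

/-! ### Texts, suffix arrays and LCP-arrays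

A text is a finite list of natural numbers (its characters).  All positions and all array
indices run from `1` to `n`, where `n` is the length of the text. -/

/-- The character `T[j]`, for `1 ≤ j ≤ n`. -/
def textChar (T : List ℕ) (j : ℕ) : ℕ := T.getD (j - 1) 0

/-- The suffix `T_{p..n}`, for `1 ≤ p ≤ n`. -/
def suffixAt (T : List ℕ) (p : ℕ) : List ℕ := T.drop (p - 1)

/-- The suffix array of `T` as a list: the positions `1, …, n`, sorted by the lexicographic order
of the suffixes that start there. -/
def suffixArray (T : List ℕ) : List ℕ :=
  (List.range' 1 T.length).insertionSort (fun p q => suffixAt T p ≤ suffixAt T q)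

/-- The entry `A[i]` of the suffix array, for `1 ≤ i ≤ n`. -/
def saEntry (T : List ℕ) (i : ℕ) : ℕ := (suffixArray T).getD (i - 1) 0

/-- The length of the longest common prefix of `T_{p..n}` and `T_{q..n}`: the greatest `k` such
that both have length at least `k` and their first `k` characters agree. -/
def lcpLength (T : List ℕ) (p q : ℕ) : ℕ :=
  Nat.findGreatest
    (fun k => k ≤ (suffixAt T p).length ∧ k ≤ (suffixAt T q).length ∧
      (suffixAt T p).take k = (suffixAt T q).take k) T.length

/-- The entry `H[i]` of the LCP-array: `H[1] = 0`, and for `1 < i ≤ n` the length of the longest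
common prefix of the suffixes that start at `A[i-1]` and at `A[i]`. -/
def lcpEntry (T : List ℕ) (i : ℕ) : ℕ :=
  if i ≤ 1 then 0 else lcpLength T (saEntry T (i - 1)) (saEntry T i)

/-! ### The suffix array is what it should be -/

theorem suffixArray_perm (T : List ℕ) : (suffixArray T).Perm (List.range' 1 T.length) :=
  List.perm_insertionSort _ _

theorem suffixArray_length (T : List ℕ) : (suffixArray T).length = T.length := by
  simpa using (suffixArray_perm T).length_eq

/-- The suffixes are strictly increasing along the suffix array. -/
theorem suffixAt_saEntry_lt (T : List ℕ) (i : ℕ) (h1 : 1 ≤ i) (h2 : i < T.length) :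
    suffixAt T (saEntry T i) < suffixAt T (saEntry T (i + 1)) := by
  have hlen := suffixArray_length T
  have hp : (suffixArray T).Pairwise (fun p q => suffixAt T p ≤ suffixAt T q) := by
    have : IsTrans ℕ (fun p q => suffixAt T p ≤ suffixAt T q) := ⟨fun _ _ _ h h' => le_trans h h'⟩
    have : Std.Total (fun p q => suffixAt T p ≤ suffixAt T q) := ⟨fun _ _ => le_total _ _⟩
    exact List.pairwise_insertionSort _ _
  have hnd : (suffixArray T).Nodup := (suffixArray_perm T).nodup_iff.2 List.nodup_range'
  have ha : i - 1 < (suffixArray T).length := by omega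
  have hb : i < (suffixArray T).length := by omega
  have ea : saEntry T i = (suffixArray T)[i - 1] := by simp [saEntry, List.getD, ha]
  have eb : saEntry T (i + 1) = (suffixArray T)[i] := by simp [saEntry, List.getD, hb]
  have ma : saEntry T i ∈ List.range' 1 T.length := by
    rw [ea]; exact (suffixArray_perm T).mem_iff.1 (List.getElem_mem ha)
  have mb : saEntry T (i + 1) ∈ List.range' 1 T.length := by
    rw [eb]; exact (suffixArray_perm T).mem_iff.1 (List.getElem_mem hb)
  have hle : suffixAt T (saEntry T i) ≤ suffixAt T (saEntry T (i + 1)) := by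
    rw [ea, eb]; exact List.pairwise_iff_getElem.1 hp _ _ ha hb (by omega)
  refine lt_of_le_of_ne hle fun h => ?_
  have hl := congrArg List.length h
  simp only [suffixAt, List.length_drop] at hl
  rw [List.mem_range'_1] at ma mb
  have he : (suffixArray T)[i - 1] = (suffixArray T)[i] := by rw [← ea, ← eb]; omega
  have := (hnd.getElem_inj_iff).1 he
  omega

/-! ### The word-RAM -/

/-- The arithmetic, bitwise and comparison operations of the machine. -/
inductive WordOp where
  | add | sub | mul | div | mod | and | or | xor | shl | shr | lt | eq

/-- The operations on words of `w` bits; all results are reduced modulo `2 ^ w`. -/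
def WordOp.eval (w : ℕ) : WordOp → ℕ → ℕ → ℕ
  | .add, x, y => (x + y) % 2 ^ w
  | .sub, x, y => (x + (2 ^ w - y)) % 2 ^ w
  | .mul, x, y => (x * y) % 2 ^ w
  | .div, x, y => (x / y) % 2 ^ w
  | .mod, x, y => (x % y) % 2 ^ w
  | .and, x, y => (x &&& y) % 2 ^ w
  | .or,  x, y => (x ||| y) % 2 ^ w
  | .xor, x, y => (x ^^^ y) % 2 ^ w
  | .shl, x, y => (x * 2 ^ y) % 2 ^ w
  | .shr, x, y => (x / 2 ^ y) % 2 ^ w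
  | .lt,  x, y => (if x < y then 1 else 0) % 2 ^ w
  | .eq,  x, y => (if x = y then 1 else 0) % 2 ^ w

/-- Programs of the machine.  `P` is the type of names of external procedures that the program may
call.  The numbers `r`, `a`, `b` in the constructors are names of registers. -/
inductive Prog (P : Type) where
  /-- Do nothing. -/
  | skip : Prog P
  /-- Put the constant `c` into register `r`. -/
  | const (r c : ℕ) : Prog P
  /-- Copy register `a` into register `r`. -/
  | move (r a : ℕ) : Prog P
  /-- Apply an operation to registers `a` and `b`, with the result in register `r`. -/
  | op (o : WordOp) (r a b : ℕ) : Prog P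
  /-- Load into `r` the cell of working memory whose address is in register `a`. -/
  | load (r a : ℕ) : Prog P
  /-- Store register `a` in the cell of working memory whose address is in register `r`. -/
  | store (r a : ℕ) : Prog P
  /-- Read into `r` the word of the stored data structure whose address is in register `a`. -/
  | read (r a : ℕ) : Prog P
  /-- Call the procedure `p` with the argument in register `a`; the result goes to `r`. -/
  | call (p : P) (r a : ℕ) : Prog P
  /-- Sequential composition. -/
  | seq (c d : Prog P) : Prog P
  /-- If register `a` is nonzero then `c`, else `d`. -/
  | ite (a : ℕ) (c d : Prog P) : Prog P
  /-- While register `a` is nonzero, `c`. -/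
  | loop (a : ℕ) (c : Prog P) : Prog P

/-- The state of the machine: registers and working memory. -/
@[ext] structure RamState where
  reg : ℕ → ℕ
  mem : ℕ → ℕ

/-- Assign the value `v` to the register `r`. -/
def RamState.set (s : RamState) (r v : ℕ) : RamState :=
  { s with reg := Function.update s.reg r v }

/-- The word with address `a` of a bit string `B` that is packed into words of `w` bits (padded
with zeros behind its end). -/
def packedWord (w : ℕ) (B : List Bool) (a : ℕ) : ℕ :=
  Nat.ofBits (fun t : Fin w => B.getD (a * w + t) false)

/-- `Exec w B env c s k s'`: on the machine with word width `w`, with the bit string `B` as the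
stored (read-only) data structure, the program `c` started in state `s` halts in state `s'` after
`k` steps.  `env p x y m` says that the external procedure `p`, called with argument `x`, returns
`y` after `m` steps; these steps are charged to the caller.  Every instruction and every test of
a condition takes one step. -/
inductive Exec {P : Type} (w : ℕ) (B : List Bool) (env : P → ℕ → ℕ → ℕ → Prop) :
    Prog P → RamState → ℕ → RamState → Prop
  | skip (s) : Exec w B env .skip s 1 s
  | const (s r c) : Exec w B env (.const r c) s 1 (s.set r (c % 2 ^ w))
  | move (s r a) : Exec w B env (.move r a) s 1 (s.set r (s.reg a))
  | op (s o r a b) : Exec w B env (.op o r a b) s 1 (s.set r (o.eval w (s.reg a) (s.reg b)))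
  | load (s r a) : Exec w B env (.load r a) s 1 (s.set r (s.mem (s.reg a)))
  | store (s r a) : Exec w B env (.store r a) s 1
      { s with mem := Function.update s.mem (s.reg r) (s.reg a) }
  | read (s r a) : Exec w B env (.read r a) s 1 (s.set r (packedWord w B (s.reg a)))
  | call (s p r a y m) (h : env p (s.reg a) y m) :
      Exec w B env (.call p r a) s (m + 1) (s.set r y)
  | seq {c d s s' s'' k m} (hc : Exec w B env c s k s') (hd : Exec w B env d s' m s'') :
      Exec w B env (.seq c d) s (k + m) s''
  | iteTrue {a c d s s' k} (h : s.reg a ≠ 0) (hc : Exec w B env c s k s') :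
      Exec w B env (.ite a c d) s (k + 1) s'
  | iteFalse {a c d s s' k} (h : s.reg a = 0) (hd : Exec w B env d s k s') :
      Exec w B env (.ite a c d) s (k + 1) s'
  | loopStop {a c s} (h : s.reg a = 0) : Exec w B env (.loop a c) s 1 s
  | loopStep {a c s s' s'' k m} (h : s.reg a ≠ 0) (hc : Exec w B env c s k s')
      (hl : Exec w B env (.loop a c) s' m s'') :
      Exec w B env (.loop a c) s (k + m + 1) s''

/-- The start of a query: the argument `x` is in register `0`, the length `n` of the text in
register `1` and the word width `w` in register `2`; everything else is zero. -/
def queryStart (w n x : ℕ) : RamState where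
  reg := fun r => if r = 0 then x else if r = 1 then n else if r = 2 then w else 0
  mem := fun _ => 0

/-- The query program `c` on the data structure `B`, for a text of length `n` and with argument
`x`, halts after `k` steps with the answer `y` in register `0`. -/
def Answers {P : Type} (w : ℕ) (B : List Bool) (env : P → ℕ → ℕ → ℕ → Prop) (c : Prog P)
    (n x y k : ℕ) : Prop :=
  ∃ s' : RamState, Exec w B env c (queryStart w n x) k s' ∧ s'.reg 0 = y

/-! ### Compressed suffix arrays and LCP structures -/

/-- The two procedures that a compressed suffix array offers. -/
inductive SAProc where
  /-- `i ↦ A[i]` -/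
  | entry
  /-- `j ↦ T[j]` -/
  | char

/-- A representation of suffix arrays: the bits that are stored for a text, and a program for each
of the two procedures.  These programs call no external procedures. -/
structure SARep where
  bits : List ℕ → List Bool
  prog : SAProc → Prog Empty

/-- The input-output-time relation of the procedures of a suffix array representation, when it is
stored for the text `T` on a machine with word width `w`. -/
def SARep.proc (A : SARep) (w : ℕ) (T : List ℕ) (p : SAProc) (x y k : ℕ) : Prop :=
  Answers w (A.bits T) (fun e : Empty => e.elim) (A.prog p) T.length x y k

/-- `A` is a compressed suffix array for the texts in `K`, where `w n` is the word width for texts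
of length `n`: it computes every entry `A[i]` in at most `tA n` steps, and retrieves every
character `T[j]` in at most `tC n` steps. -/
def SARep.IsCSA (A : SARep) (w : ℕ → ℕ) (K : Set (List ℕ)) (tA tC : ℕ → ℕ) : Prop :=
  ∀ T ∈ K, ∀ i, 1 ≤ i → i ≤ T.length →
    (∃ k ≤ tA T.length, A.proc (w T.length) T .entry i (saEntry T i) k) ∧
    (∃ k ≤ tC T.length, A.proc (w T.length) T .char i (textChar T i) k)

/-- A representation of LCP-arrays on top of a suffix array representation: the additional bits
that are stored for a text, and a query program, which sees those bits and may call the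
procedures of the suffix array representation. -/
structure LCPRep where
  bits : List ℕ → List Bool
  prog : Prog SAProc

/-- With `A` as the suffix array representation, `L` gives access to every entry `H[i]` of the
LCP-array of every text in `K`, in at most `t n` steps for texts of length `n`; the time that is
spent inside the procedures of `A` is included. -/
def LCPRep.HasAccessTime (L : LCPRep) (A : SARep) (w : ℕ → ℕ) (K : Set (List ℕ))
    (t : ℕ → ℕ) : Prop :=
  ∀ T ∈ K, ∀ i, 1 ≤ i → i ≤ T.length →
    ∃ k ≤ t T.length,
      Answers (w T.length) (L.bits T) (A.proc (w T.length) T) L.prog T.length i (lcpEntry T i) k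

/-!
The LCP values are kept in text order. With zero-based positions, `I j = PLCP[j + 1] + j` is a
monotone function bounded by `n`: this is Kasai's inequality (`maxLcp_le_succ`,
`lcpProfile_mono`), and `lcpEntry_eq_maxLcp` links the two orders. The query for `H[i]` obtains
`p = A[i - 1]` and `q = A[i]`, looks up some `y ≤ I (q - 1)`, and compares the suffixes at `p` and
`q` character by character, starting with the certain match length `y - (q - 1)`. The answer is
right for every such `y`, and the time is governed by the error `I (q - 1) - y`. So it is enough to
store a monotone function in `o(n)` bits up to an error of `log ^ δ n`.

This is done by sampling on two levels, as in the select structures for bit vectors. A level has a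
sample of the function at the start of each block of `s` positions. A block over which the function
grows by at least `s ^ 2` is called sparse (`Sparse`), and the function is stored explicitly inside
sparse blocks. No pointers are needed to find these values: the table of exceptions has one slot for
each interval `[v * s ^ 2, (v + 1) * s ^ 2)` of values, and the sparse block that starts with a
value in this interval owns the slot (`slotOwner_eq`). The table has about `n / s` entries. On
the upper level `s = X ^ 2`, where `X` is a power of two that is at least the number of binary digits of `n`
and `O(log n)`; entries have at most `X` bits. In a block that is not sparse the function grows by
less than `X ^ 4`, so that on the lower level, with `s = k`, relative values of `O(log log n)` bits
suffice. If the lower block is not sparse either, its sample is off by less than `k ^ 2`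
(`le_lowerValue_add`). With `M ≥ 2 / δ`, `X = 2 ^ (M * a)` and `k = 2 ^ a` this error is
`O(log ^ δ n)`, while the size is `O(n * M * a / 2 ^ a)` up to a polylogarithmic term
(`totalSize_le`), which is `o(n)`.

The structure is stored only if it has at most `n < 2 ^ w` bits (`IsLarge`), which is the case for
all large `n`; then no address computation overflows. For the other lengths nothing is stored, and
the query compares from the first character on. The first bit tells the two cases apart.
-/

set_option linter.unusedSimpArgs false

/-! ### Kasai's inequality for LCP values in text order -/

/-- Lexicographic order is decided by the first difference. -/
theorem lt_of_take_lt_take {a b : List ℕ} {k : ℕ} (h : a.take k < b.take k) : a < b := by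
  induction k generalizing a b with
  | zero => simp at h
  | succ k ih =>
    cases b with
    | nil => simp at h
    | cons y b =>
      cases a with
      | nil => exact List.nil_lt_cons y b
      | cons x a =>
        rw [List.take_succ_cons, List.take_succ_cons, List.cons_lt_cons_iff] at h
        rw [List.cons_lt_cons_iff]
        exact h.imp id fun h => ⟨h.1, ih h.2⟩

theorem take_le_take {a b : List ℕ} (h : a ≤ b) (k : ℕ) : a.take k ≤ b.take k :=
  not_lt.1 fun h' => not_lt.2 h (lt_of_take_lt_take h')

/-- In the lexicographic order, a prefix shared by two lists is shared by all lists between them. -/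
theorem take_eq_of_le_of_le {a b c : List ℕ} (hab : a ≤ b) (hbc : b ≤ c) {k : ℕ}
    (h : a.take k = c.take k) : b.take k = c.take k :=
  le_antisymm (take_le_take hbc k) (h ▸ take_le_take hab k)

theorem le_lcpLength_iff (T : List ℕ) (p q k : ℕ) :
    k ≤ lcpLength T p q ↔ k ≤ (suffixAt T p).length ∧ k ≤ (suffixAt T q).length ∧
      (suffixAt T p).take k = (suffixAt T q).take k := by
  have hs : ∀ r, (suffixAt T r).length ≤ T.length := fun r => by simp [suffixAt]
  constructor
  · intro h
    have := @Nat.findGreatest_spec 0 (fun k => k ≤ (suffixAt T p).length ∧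
      k ≤ (suffixAt T q).length ∧ (suffixAt T p).take k = (suffixAt T q).take k) _ T.length
      (Nat.zero_le _) (by simp)
    obtain ⟨h1, h2, h3⟩ := this
    refine ⟨h.trans h1, h.trans h2, ?_⟩
    have := congrArg (List.take k) h3
    rwa [List.take_take, List.take_take, min_eq_left (by exact h)] at this
  · intro h
    exact Nat.le_findGreatest (h.1.trans (hs p)) h

theorem lcpLength_le_right (T : List ℕ) (p q : ℕ) : lcpLength T p q ≤ (suffixAt T q).length :=
  ((le_lcpLength_iff T p q _).1 le_rfl).2.1

/-- The longest match between `T_{p..n}` and a lexicographically smaller suffix. By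
`lcpEntry_eq_maxLcp` this is the LCP value of position `p` in text order. -/
def maxLcp (T : List ℕ) (p : ℕ) : ℕ :=
  ((Finset.Icc 1 T.length).filter fun r => suffixAt T r < suffixAt T p).sup
    fun r => lcpLength T r p

theorem maxLcp_add_le (T : List ℕ) {j : ℕ} (hj : j < T.length) :
    maxLcp T (j + 1) + j ≤ T.length := by
  have : maxLcp T (j + 1) ≤ (suffixAt T (j + 1)).length :=
    Finset.sup_le fun r _ => lcpLength_le_right T r _
  simp [suffixAt] at this
  omega

theorem suffixAt_succ (T : List ℕ) {p : ℕ} (hp : 1 ≤ p) :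
    suffixAt T (p + 1) = (suffixAt T p).tail := by
  obtain ⟨p, rfl⟩ := Nat.exists_eq_add_of_le' hp
  simp [suffixAt]

/-- Deleting the common first character of two suffixes keeps their order and shortens the match
by one only. -/
theorem maxLcp_le_succ (T : List ℕ) {p : ℕ} (hp : 1 ≤ p) :
    maxLcp T p ≤ maxLcp T (p + 1) + 1 := by
  refine Finset.sup_le fun r hr => ?_
  simp only [Finset.mem_filter, Finset.mem_Icc] at hr
  obtain ⟨⟨hr1, hr2⟩, hlt⟩ := hr
  by_contra! hm
  obtain ⟨h1, h2, h3⟩ := (le_lcpLength_iff T r p _).1 le_rfl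
  obtain ⟨m, hm'⟩ : ∃ m, lcpLength T r p = m + 1 := ⟨_, (Nat.succ_pred_eq_of_pos (by omega)).symm⟩
  rw [hm'] at h1 h2 h3 hm
  have er := suffixAt_succ T hr1
  have ep := suffixAt_succ T hp
  have hlen : r + 1 ≤ T.length := by
    have : 2 ≤ (suffixAt T r).length := by omega
    simp [suffixAt] at this
    omega
  generalize hx : suffixAt T r = x at *
  generalize hy : suffixAt T p = y at *
  cases x with
  | nil => simp at h1
  | cons x u =>
    cases y with
    | nil => simp at h2
    | cons y v =>
      simp only [List.take_succ_cons, List.cons.injEq, List.length_cons, List.tail_cons] at *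
      obtain ⟨rfl, h3⟩ := h3
      have huv : u < v := by
        rw [List.cons_lt_cons_iff] at hlt
        simpa using hlt
      have hle : lcpLength T (r + 1) (p + 1) ≤ maxLcp T (p + 1) :=
        Finset.le_sup (f := fun r => lcpLength T r (p + 1)) (by
          simp only [Finset.mem_filter, Finset.mem_Icc, er, ep]
          exact ⟨⟨by omega, hlen⟩, huv⟩)
      have : m ≤ lcpLength T (r + 1) (p + 1) := by
        rw [le_lcpLength_iff, er, ep]
        exact ⟨by omega, by omega, h3⟩
      omega

theorem suffixAt_saEntry_strictMono (T : List ℕ) {i i' : ℕ} (h1 : 1 ≤ i) (h : i < i')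
    (h2 : i' ≤ T.length) : suffixAt T (saEntry T i) < suffixAt T (saEntry T i') := by
  induction i', h using Nat.le_induction with
  | base => exact suffixAt_saEntry_lt T i h1 (by omega)
  | succ m hm ih => exact (ih (by omega)).trans (suffixAt_saEntry_lt T m (by omega) (by omega))

theorem saEntry_mem (T : List ℕ) {i : ℕ} (h1 : 1 ≤ i) (h2 : i ≤ T.length) :
    1 ≤ saEntry T i ∧ saEntry T i ≤ T.length := by
  have hi : i - 1 < (suffixArray T).length := by rw [suffixArray_length]; omega
  have : saEntry T i = (suffixArray T)[i - 1] := by simp [saEntry, List.getD, hi]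
  have hm := (suffixArray_perm T).mem_iff.1 (List.getElem_mem hi)
  rw [← this, List.mem_range'_1] at hm
  omega

theorem exists_saEntry_eq (T : List ℕ) {r : ℕ} (h1 : 1 ≤ r) (h2 : r ≤ T.length) :
    ∃ i, 1 ≤ i ∧ i ≤ T.length ∧ saEntry T i = r := by
  have hr : r ∈ suffixArray T := by
    rw [(suffixArray_perm T).mem_iff, List.mem_range'_1]; omega
  obtain ⟨i, hi, rfl⟩ := List.getElem_of_mem hr
  refine ⟨i + 1, by omega, by rw [suffixArray_length] at hi; omega, ?_⟩
  simp [saEntry, List.getD, hi]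

/-- The neighbour in the suffix array attains the longest match with a smaller suffix. -/
theorem lcpEntry_eq_maxLcp (T : List ℕ) {i : ℕ} (h1 : 1 ≤ i) (h2 : i ≤ T.length) :
    lcpEntry T i = maxLcp T (saEntry T i) := by
  have key : ∀ r, 1 ≤ r → r ≤ T.length → suffixAt T r < suffixAt T (saEntry T i) →
      ∃ i', 1 ≤ i' ∧ i' < i ∧ saEntry T i' = r := by
    intro r hr1 hr2 hlt
    obtain ⟨i', a, b, rfl⟩ := exists_saEntry_eq T hr1 hr2
    refine ⟨i', a, ?_, rfl⟩
    by_contra! hle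
    rcases hle.eq_or_lt with rfl | hl
    · exact lt_irrefl _ hlt
    · exact lt_asymm hlt (suffixAt_saEntry_strictMono T h1 hl b)
  unfold lcpEntry maxLcp
  split_ifs with hi
  · symm
    rw [← Nat.le_zero]
    refine Finset.sup_le fun r hr => ?_
    simp only [Finset.mem_filter, Finset.mem_Icc] at hr
    obtain ⟨i', a, b, -⟩ := key r hr.1.1 hr.1.2 hr.2
    omega
  · have hm := saEntry_mem T (i := i - 1) (by omega) (by omega)
    have hlt := suffixAt_saEntry_strictMono T (i := i - 1) (i' := i) (by omega) (by omega) h2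
    refine le_antisymm (Finset.le_sup (f := fun r => lcpLength T r (saEntry T i)) (by
      simp only [Finset.mem_filter, Finset.mem_Icc]; exact ⟨hm, hlt⟩)) ?_
    refine Finset.sup_le fun r hr => ?_
    simp only [Finset.mem_filter, Finset.mem_Icc] at hr
    obtain ⟨i', a, b, rfl⟩ := key r hr.1.1 hr.1.2 hr.2
    have hle : suffixAt T (saEntry T i') ≤ suffixAt T (saEntry T (i - 1)) := by
      rcases (Nat.le_sub_one_of_lt b).eq_or_lt with rfl | hl
      · exact le_rfl
      · exact (suffixAt_saEntry_strictMono T a hl (by omega)).le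
    obtain ⟨g1, g2, g3⟩ := (le_lcpLength_iff T (saEntry T i') (saEntry T i) _).1 le_rfl
    have ht := take_eq_of_le_of_le hle hlt.le g3
    rw [le_lcpLength_iff]
    refine ⟨?_, g2, ht⟩
    have := congrArg List.length ht
    rw [List.length_take, List.length_take, min_eq_left g2] at this
    exact min_eq_left_iff.1 this

/-- The LCP values in text order, made monotone by adding the (zero-based) position; constant
behind the end of the text. -/
def lcpProfile (T : List ℕ) (j : ℕ) : ℕ :=
  if j < T.length then maxLcp T (j + 1) + j else T.length

theorem lcpProfile_le (T : List ℕ) (j : ℕ) : lcpProfile T j ≤ T.length := by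
  unfold lcpProfile
  split_ifs with h
  · exact maxLcp_add_le T h
  · exact le_rfl

theorem lcpProfile_mono (T : List ℕ) : Monotone (lcpProfile T) := by
  refine monotone_nat_of_le_succ fun j => ?_
  by_cases h : j + 1 < T.length
  · have := maxLcp_le_succ T (p := j + 1) (by omega)
    simp only [lcpProfile, h, show j < T.length by omega, if_true]
    omega
  · rw [show lcpProfile T (j + 1) = T.length by simp [lcpProfile, h]]
    exact lcpProfile_le T j

theorem lcpProfile_saEntry (T : List ℕ) {i : ℕ} (h1 : 1 ≤ i) (h2 : i ≤ T.length) :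
    lcpProfile T (saEntry T i - 1) = lcpEntry T i + (saEntry T i - 1) := by
  have := saEntry_mem T h1 h2
  rw [lcpEntry_eq_maxLcp T h1 h2, lcpProfile, if_pos (by omega), Nat.sub_add_cancel this.1]

/-- A match of length at least `l` extends by one character if and only if the next characters
exist and agree. -/
theorem lt_lcpLength_iff (T : List ℕ) {p q l : ℕ} (hp : 1 ≤ p) (hq : 1 ≤ q)
    (hl : l ≤ lcpLength T p q) :
    l < lcpLength T p q ↔ (l < T.length - (p - 1) ∧ l < T.length - (q - 1)) ∧
      textChar T (p + l) = textChar T (q + l) := by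
  obtain ⟨h1, h2, h3⟩ := (le_lcpLength_iff T p q _).1 hl
  rw [← Nat.succ_le_iff, le_lcpLength_iff, and_assoc]
  have hlen : ∀ r, (suffixAt T r).length = T.length - (r - 1) := fun r => by simp [suffixAt]
  rw [hlen, hlen, Nat.succ_le_iff, Nat.succ_le_iff]
  refine and_congr_right fun a => and_congr_right fun b => ?_
  have ht : ∀ r, 1 ≤ r → l < T.length - (r - 1) →
      (suffixAt T r).take (l + 1) = (suffixAt T r).take l ++ [textChar T (r + l)] := by
    intro r hr hlt
    have hlt' : l < (suffixAt T r).length := by rw [hlen]; exact hlt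
    rw [List.take_succ_eq_append_getElem hlt']
    congr 2
    have : r + l - 1 < T.length := by omega
    simp [suffixAt, textChar, List.getD, this]
    congr 1
    omega
  rw [ht p hp a, ht q hq b, h3]
  simp

/-! ### Reasoning about programs of the word-RAM -/

theorem RamState.reg_set (s : RamState) (r v r' : ℕ) :
    (s.set r v).reg r' = if r' = r then v else s.reg r' := by
  simp [RamState.set, Function.update_apply]

/-- Sequential composition of a list of programs. -/
def block {P : Type} : List (Prog P) → Prog P
  | [] => .skip
  | c :: l => .seq c (block l)

/-- Total correctness with a time bound: `c` started in `s` halts within `K` steps in a state that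
satisfies `Q`. -/
def Runs {P : Type} (w : ℕ) (B : List Bool) (env : P → ℕ → ℕ → ℕ → Prop) (c : Prog P)
    (s : RamState) (K : ℕ) (Q : RamState → Prop) : Prop :=
  ∃ k ≤ K, ∃ s', Exec w B env c s k s' ∧ Q s'

namespace Runs

variable {P : Type} {w : ℕ} {B : List Bool} {env : P → ℕ → ℕ → ℕ → Prop} {c d : Prog P}
  {l : List (Prog P)} {s : RamState} {K M : ℕ} {Q Q' : RamState → Prop}

theorem mono (h : Runs w B env c s K Q) (hK : K ≤ M) (hQ : ∀ s', Q s' → Q' s') :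
    Runs w B env c s M Q' := by
  obtain ⟨k, hk, s', he, hq⟩ := h
  exact ⟨k, hk.trans hK, s', he, hQ _ hq⟩

theorem seq (h : Runs w B env c s K fun s' => Runs w B env d s' M Q) :
    Runs w B env (.seq c d) s (K + M) Q := by
  obtain ⟨k, hk, s', he, m, hm, s'', he', hq⟩ := h
  exact ⟨k + m, by omega, s'', .seq he he', hq⟩

theorem nil (h : Q s) : Runs w B env (block []) s 1 Q := ⟨1, le_rfl, s, .skip s, h⟩

theorem cons (h : Runs w B env c s K fun s' => Runs w B env (block l) s' M Q) :
    Runs w B env (block (c :: l)) s (K + M) Q := h.seq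

theorem cons' {N : ℕ} (h : Runs w B env c s K Q') (hN : K + M ≤ N)
    (h' : ∀ s', Q' s' → Runs w B env (block l) s' M Q) : Runs w B env (block (c :: l)) s N Q :=
  (cons (h.mono le_rfl h')).mono hN fun _ h => h

theorem const {r x : ℕ} (hx : x < 2 ^ w) (h : Runs w B env (block l) (s.set r x) M Q) :
    Runs w B env (block (.const r x :: l)) s (M + 1) Q := by
  rw [add_comm]
  refine cons ⟨1, le_rfl, _, .const s r x, ?_⟩
  rwa [Nat.mod_eq_of_lt hx]

theorem move {r a : ℕ} (h : Runs w B env (block l) (s.set r (s.reg a)) M Q) :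
    Runs w B env (block (.move r a :: l)) s (M + 1) Q := by
  rw [add_comm]
  exact cons ⟨1, le_rfl, _, .move s r a, h⟩

theorem op {o : WordOp} {r a b : ℕ} (v : ℕ) (hv : o.eval w (s.reg a) (s.reg b) = v)
    (h : Runs w B env (block l) (s.set r v) M Q) :
    Runs w B env (block (.op o r a b :: l)) s (M + 1) Q := by
  rw [add_comm]
  subst hv
  exact cons ⟨1, le_rfl, _, .op s o r a b, h⟩

theorem read {r a : ℕ} (x : ℕ) (hx : s.reg a = x)
    (h : Runs w B env (block l) (s.set r (packedWord w B x)) M Q) :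
    Runs w B env (block (.read r a :: l)) s (M + 1) Q := by
  rw [add_comm]
  subst hx
  exact cons ⟨1, le_rfl, _, .read s r a, h⟩

theorem call {p : P} {r a : ℕ} (y m : ℕ) (hp : ∃ k ≤ m, env p (s.reg a) y k)
    (h : Runs w B env (block l) (s.set r y) M Q) :
    Runs w B env (block (.call p r a :: l)) s (M + (m + 1)) Q := by
  obtain ⟨k, hk, hp⟩ := hp
  rw [add_comm]
  exact cons ⟨k + 1, by omega, _, .call s p r a y k hp, h⟩

theorem ite {a : ℕ} (h1 : s.reg a ≠ 0 → Runs w B env c s K Q)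
    (h2 : s.reg a = 0 → Runs w B env d s K Q) : Runs w B env (.ite a c d) s (K + 1) Q := by
  by_cases h : s.reg a = 0
  · obtain ⟨k, hk, s', he, hq⟩ := h2 h
    exact ⟨k + 1, by omega, s', .iteFalse h he, hq⟩
  · obtain ⟨k, hk, s', he, hq⟩ := h1 h
    exact ⟨k + 1, by omega, s', .iteTrue h he, hq⟩

/-- The rule for loops: `Inv m` is the invariant with at most `m` rounds to go. -/
theorem loop {a : ℕ} (Inv : ℕ → RamState → Prop)
    (hstep : ∀ m s, Inv m s → s.reg a ≠ 0 →
      ∃ m', m = m' + 1 ∧ Runs w B env c s K fun s' => Inv m' s')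
    (hexit : ∀ m s, Inv m s → s.reg a = 0 → Q s) (m : ℕ) (s : RamState) (hI : Inv m s) :
    Runs w B env (.loop a c) s (m * (K + 1) + 1) Q := by
  induction m generalizing s with
  | zero =>
    by_cases h : s.reg a = 0
    · exact ⟨1, by omega, s, .loopStop h, hexit _ _ hI h⟩
    · obtain ⟨m', hm', -⟩ := hstep 0 s hI h
      omega
  | succ m ih =>
    by_cases h : s.reg a = 0
    · exact ⟨1, by omega, s, .loopStop h, hexit _ _ hI h⟩
    · obtain ⟨m', hm', k, hk, s', he, hI'⟩ := hstep _ s hI h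
      obtain rfl : m = m' := by omega
      obtain ⟨k', hk', s'', he', hq⟩ := ih s' hI'
      exact ⟨k + k' + 1, by rw [Nat.succ_mul]; omega, s'', .loopStep h he he', hq⟩

end Runs

namespace WordOp

variable {w x y : ℕ}

theorem eval_add (h : x + y < 2 ^ w) : WordOp.add.eval w x y = x + y := Nat.mod_eq_of_lt h

theorem eval_sub (hx : x < 2 ^ w) (h : y ≤ x) : WordOp.sub.eval w x y = x - y := by
  have : x + (2 ^ w - y) = (x - y) + 2 ^ w := by omega
  rw [WordOp.eval, this, Nat.add_mod_right, Nat.mod_eq_of_lt (by omega)]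

theorem eval_mul (h : x * y < 2 ^ w) : WordOp.mul.eval w x y = x * y := Nat.mod_eq_of_lt h

theorem eval_div (h : x < 2 ^ w) : WordOp.div.eval w x y = x / y :=
  Nat.mod_eq_of_lt ((Nat.div_le_self x y).trans_lt h)

theorem eval_mod (h : x < 2 ^ w) : WordOp.mod.eval w x y = x % y :=
  Nat.mod_eq_of_lt ((Nat.mod_le x y).trans_lt h)

theorem eval_shl (h : x * 2 ^ y < 2 ^ w) : WordOp.shl.eval w x y = x * 2 ^ y :=
  Nat.mod_eq_of_lt h

theorem eval_shr (h : x < 2 ^ w) : WordOp.shr.eval w x y = x / 2 ^ y :=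
  Nat.mod_eq_of_lt ((Nat.div_le_self x _).trans_lt h)

theorem eval_lt (h : 0 < w) : WordOp.lt.eval w x y = if x < y then 1 else 0 := by
  refine Nat.mod_eq_of_lt ?_
  have := Nat.one_lt_two_pow h.ne'
  split_ifs <;> omega

theorem eval_eq (h : 0 < w) : WordOp.eq.eval w x y = if x = y then 1 else 0 := by
  refine Nat.mod_eq_of_lt ?_
  have := Nat.one_lt_two_pow h.ne'
  split_ifs <;> omega

end WordOp

/-! ### Arrays with entries of fixed width -/

theorem testBit_packedWord (w : ℕ) (B : List Bool) (a t : ℕ) :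
    (packedWord w B a).testBit t = (decide (t < w) && B.getD (a * w + t) false) := by
  unfold packedWord
  by_cases h : t < w
  · rw [Nat.testBit_ofBits_lt _ _ h]; simp [h]
  · rw [Nat.testBit_ofBits_ge _ _ (by omega)]; simp [h]

theorem packedWord_lt (w : ℕ) (B : List Bool) (a : ℕ) : packedWord w B a < 2 ^ w :=
  Nat.ofBits_lt_two_pow _

/-- A field of `f ≤ w` bits at bit address `p`, which may straddle two words, put together by
shifts. -/
theorem testBit_field {w f : ℕ} (B : List Bool) (p : ℕ) (hw : 0 < w) (hf : f ≤ w) (t : ℕ) :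
    ((packedWord w B (p / w) / 2 ^ (p % w) |||
      packedWord w B (p / w + 1) * 2 ^ (w - p % w) % 2 ^ w) * 2 ^ (w - f) % 2 ^ w
        / 2 ^ (w - f)).testBit t = (decide (t < f) && B.getD (p + t) false) := by
  have ho := Nat.mod_lt p hw
  have hp := Nat.div_add_mod' p w
  rw [Nat.testBit_div_two_pow, Nat.testBit_mod_two_pow, Nat.testBit_mul_two_pow,
    Nat.testBit_or, Nat.testBit_div_two_pow, Nat.testBit_mod_two_pow, Nat.testBit_mul_two_pow,
    testBit_packedWord, testBit_packedWord]
  by_cases htf : t < f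
  · have e1 : t + (w - f) - (w - f) = t := by omega
    rw [e1]
    by_cases h : t + p % w < w
    · have h' : ¬ (w ≤ t + p % w) := by omega
      have : p / w * w + (t + p % w) = p + t := by omega
      simp [htf, h, h', this, show t + (w - f) < w by omega]
    · have : (p / w + 1) * w + (t - (w - p % w)) = p + t := by rw [Nat.succ_mul]; omega
      simp only [this]
      simp [htf, h, show t + (w - f) < w by omega, show w ≤ t + p % w by omega,
        show t < w by omega, show t - (w - p % w) < w by omega]
  · simp [htf, show ¬ t + (w - f) < w by omega]

/-- The bit string of the array `g 0, …, g (N - 1)` with `f` bits for each entry. -/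
def packArr (f N : ℕ) (g : ℕ → ℕ) : List Bool :=
  (List.range (f * N)).map fun p => (g (p / f)).testBit (p % f)

theorem length_packArr (f N : ℕ) (g : ℕ → ℕ) : (packArr f N g).length = f * N := by
  simp [packArr]

/-- The bit string `B` contains the array `g 0, …, g (N - 1)`, with `f` bits for each entry, at
bit address `base`. -/
def HasArr (B : List Bool) (base f N : ℕ) (g : ℕ → ℕ) : Prop :=
  ∀ p < f * N, B.getD (base + p) false = (g (p / f)).testBit (p % f)

theorem hasArr_append (B C : List Bool) (f N : ℕ) (g : ℕ → ℕ) :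
    HasArr (B ++ (packArr f N g ++ C)) B.length f N g := by
  intro p hp
  have : p < (packArr f N g).length := by rwa [length_packArr]
  rw [List.getD_append_right _ _ _ _ (by omega), Nat.add_sub_cancel_left,
    List.getD_append _ _ _ _ this]
  simp [packArr, List.getD, hp]

/-- Read entry number `reg 9` of the array with `reg 8` entries of `reg 7` bits at bit address
`reg 6` into register `10`, and move `reg 6` behind the array. Register `21` holds the word width.
Registers from `17` on are not changed. -/
def readArr {P : Type} : Prog P := block
  [.op .mul 11 9 7, .op .add 11 6 11, .op .div 12 11 21, .op .mod 13 11 21,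
   .read 10 12, .op .shr 10 10 13,
   .const 14 1, .op .add 12 12 14, .read 15 12, .op .sub 16 21 13, .op .shl 15 15 16,
   .op .or 10 10 15, .op .sub 16 21 7, .op .shl 10 10 16, .op .shr 10 10 16,
   .op .mul 11 7 8, .op .add 6 6 11]

theorem runs_readArr_cons {P : Type} {w : ℕ} {B : List Bool} {env : P → ℕ → ℕ → ℕ → Prop}
    {l : List (Prog P)} {M : ℕ} {Q : RamState → Prop} {s : RamState}
    {base f N idx : ℕ} {g : ℕ → ℕ} (hB : HasArr B base f N g)
    (h6 : s.reg 6 = base) (h7 : s.reg 7 = f) (h8 : s.reg 8 = N) (h9 : s.reg 9 = idx)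
    (h21 : s.reg 21 = w) (hidx : idx < N) (hf : 0 < f) (hfw : f ≤ w)
    (hb : base + f * N < 2 ^ w)
    (h : ∀ s', s'.reg 6 = base + f * N → s'.reg 10 = g idx % 2 ^ f →
      (∀ r, 17 ≤ r → s'.reg r = s.reg r) → Runs w B env (block l) s' M Q) :
    Runs w B env (block (readArr :: l)) s (M + 18) Q := by
  have hw : 0 < w := by omega
  have hw2 : w < 2 ^ w := Nat.lt_two_pow_self
  have h1 : 1 < 2 ^ w := Nat.one_lt_two_pow hw.ne'
  have hfi : f * idx + f ≤ f * N := by rw [← Nat.mul_succ]; exact Nat.mul_le_mul_left _ hidx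
  have hif : idx * f = f * idx := mul_comm _ _
  set p := base + idx * f with hp
  have ho := Nat.mod_lt p hw
  have hpd : p / w ≤ p := Nat.div_le_self _ _
  -- the shifts by `w - f` cut off all but `f` bits
  have hval : (packedWord w B (p / w) / 2 ^ (p % w) |||
      packedWord w B (p / w + 1) * 2 ^ (w - p % w) % 2 ^ w) * 2 ^ (w - f) % 2 ^ w
        / 2 ^ (w - f) = g idx % 2 ^ f := by
    refine Nat.eq_of_testBit_eq fun t => ?_
    rw [testBit_field B p hw hfw, Nat.testBit_mod_two_pow]
    by_cases ht : t < f
    · have := hB (idx * f + t) (by omega)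
      rw [← add_assoc, ← hp, add_comm (idx * f), Nat.add_mul_div_right _ _ hf,
        Nat.div_eq_of_lt ht, zero_add, Nat.add_mul_mod_self_right, Nat.mod_eq_of_lt ht] at this
      simp [ht]
      simpa using this
    · simp [ht]
  have hA := packedWord_lt w B (p / w)
  have hor : (packedWord w B (p / w) / 2 ^ (p % w) |||
      packedWord w B (p / w + 1) * 2 ^ (w - p % w) % 2 ^ w) < 2 ^ w :=
    Nat.or_lt_two_pow ((Nat.div_le_self _ _).trans_lt hA) (Nat.mod_lt _ (by omega))
  refine .cons' (K := 18) (Q' := fun s' => s'.reg 6 = base + f * N ∧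
    s'.reg 10 = g idx % 2 ^ f ∧ ∀ r, 17 ≤ r → s'.reg r = s.reg r) ?_ (by omega)
    fun s' hs' => h s' hs'.1 hs'.2.1 hs'.2.2
  -- the values of the registers after each instruction
  refine .op (idx * f) ?_ <| .op p ?_ <| .op (p / w) ?_ <| .op (p % w) ?_ <|
    .read (p / w) ?_ <| .op (packedWord w B (p / w) / 2 ^ (p % w)) ?_ <|
    .const h1 <| .op (p / w + 1) ?_ <| .read (p / w + 1) ?_ <| .op (w - p % w) ?_ <|
    .op (packedWord w B (p / w + 1) * 2 ^ (w - p % w) % 2 ^ w) ?_ <|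
    .op (packedWord w B (p / w) / 2 ^ (p % w) |||
      packedWord w B (p / w + 1) * 2 ^ (w - p % w) % 2 ^ w) ?_ <|
    .op (w - f) ?_ <| .op _ rfl <| .op (g idx % 2 ^ f) ?_ <| .op (f * N) ?_ <|
    .op (base + f * N) ?_ <| .nil ⟨?_, ?_, ?_⟩
  all_goals simp only [RamState.reg_set, h6, h7, h8, h9, h21, reduceIte,
    Nat.reduceEqDiff]
  · exact WordOp.eval_mul (by omega)
  · exact WordOp.eval_add (by omega)
  · exact WordOp.eval_div (by omega)
  · exact WordOp.eval_mod (by omega)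
  · exact WordOp.eval_shr hA
  · exact WordOp.eval_add (by omega)
  · exact WordOp.eval_sub hw2 ho.le
  · rfl
  · exact Nat.mod_eq_of_lt hor
  · exact WordOp.eval_sub hw2 hfw
  · rw [← hval]
    exact WordOp.eval_shr (Nat.mod_lt _ (by omega))
  · exact WordOp.eval_mul (by omega)
  · exact WordOp.eval_add hb
  · intro r hr
    simp [show r ≠ 6 by omega, show r ≠ 10 by omega, show r ≠ 11 by omega, show r ≠ 12 by omega,
      show r ≠ 13 by omega, show r ≠ 14 by omega, show r ≠ 15 by omega, show r ≠ 16 by omega]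

/-! ### One level of a sampled monotone function -/

/-- The values of `I` grow by at least `s ^ 2` over the `u`-th block of `s` positions. -/
def Sparse (I : ℕ → ℕ) (s u : ℕ) : Prop := I (u * s) + s * s ≤ I ((u + 1) * s)

/-- A sparse block that starts with a value in `[v * s ^ 2, (v + 1) * s ^ 2)`; there is at most
one. -/
noncomputable def slotOwner (I : ℕ → ℕ) (s v : ℕ) : ℕ :=
  sInf {u | Sparse I s u ∧ I (u * s) / (s * s) = v}

theorem slotOwner_eq {I : ℕ → ℕ} (hI : Monotone I) {s u : ℕ} (hs : 0 < s) (hu : Sparse I s u) :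
    slotOwner I s (I (u * s) / (s * s)) = u := by
  -- from the start of a sparse block to the start of any later block, `I` grows by a full slot
  have key : ∀ a b, Sparse I s a → a < b → I (a * s) / (s * s) < I (b * s) / (s * s) := by
    intro a b ha hab
    have h1 : I (a * s) + s * s ≤ I (b * s) := ha.trans (hI (Nat.mul_le_mul_right _ hab))
    have := Nat.div_le_div_right (c := s * s) h1
    rw [Nat.add_div_right _ (Nat.mul_pos hs hs)] at this
    omega
  have hmem : u ∈ {u' | Sparse I s u' ∧ I (u' * s) / (s * s) = I (u * s) / (s * s)} := ⟨hu, rfl⟩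
  obtain ⟨h1, h2⟩ := Nat.sInf_mem ⟨u, hmem⟩
  change Sparse I s (slotOwner I s _) at h1
  change I (slotOwner I s (I (u * s) / (s * s)) * s) / (s * s) = _ at h2
  rcases lt_trichotomy (slotOwner I s (I (u * s) / (s * s))) u with h | h | h
  · exact absurd h2 (key _ _ h1 h).ne
  · exact h
  · exact absurd h2 (key _ _ hu h).ne'

/-- The table of exceptions: the slots have `s` entries, and slot `v` holds the increments of `I`
inside the sparse block that owns it. -/
noncomputable def exceptions (I : ℕ → ℕ) (s x : ℕ) : ℕ :=
  I (slotOwner I s (x / s) * s + x % s) - I (slotOwner I s (x / s) * s)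

theorem exceptions_eq {I : ℕ → ℕ} (hI : Monotone I) {s j : ℕ} (hs : 0 < s)
    (hu : Sparse I s (j / s)) :
    exceptions I s (I (j / s * s) / (s * s) * s + j % s) = I j - I (j / s * s) := by
  have h1 : (I (j / s * s) / (s * s) * s + j % s) / s = I (j / s * s) / (s * s) := by
    rw [add_comm, Nat.add_mul_div_right _ _ hs, Nat.div_eq_of_lt (Nat.mod_lt _ hs), zero_add]
  have h2 : (I (j / s * s) / (s * s) * s + j % s) % s = j % s := by
    rw [add_comm, Nat.add_mul_mod_self_right, Nat.mod_mod]
  rw [exceptions, h1, h2, slotOwner_eq hI hs hu, Nat.div_add_mod']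

/-- The bit string of a level: samples `V` and flags `F`, one for every block of `s` positions, and
a table of exceptions `E`. -/
def levelBits (f n s : ℕ) (V F E : ℕ → ℕ) : List Bool :=
  packArr f (n / s + 1) V ++ (packArr 1 (n / s + 1) F ++ packArr f ((n / (s * s) + 1) * s) E)

/-- The number of bits of a level. -/
def levelSize (f n s : ℕ) : ℕ :=
  f * (n / s + 1) + 1 * (n / s + 1) + f * ((n / (s * s) + 1) * s)

theorem length_levelBits (f n s : ℕ) (V F E : ℕ → ℕ) :
    (levelBits f n s V F E).length = levelSize f n s := by
  simp only [levelBits, List.length_append, length_packArr, levelSize]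
  ring

/-- The value that is looked up in a level for position `j`, when the higher levels contributed
`y`. -/
def levelValue (f s : ℕ) (V F E : ℕ → ℕ) (j y : ℕ) : ℕ :=
  y + V (j / s) % 2 ^ f +
    E ((y + V (j / s) % 2 ^ f) / (s * s) * s + j % s) % 2 ^ f * F (j / s)

/-- With `n` in register `20` and `1` in `33`, look up position `reg 24` in the level at bit
address `reg 6`, and add what is found to register `19`. The block length is in register `rs` and
the width of the entries in `rf`. The exception is read in any case, and multiplied by the flag. -/
def readLevel {P : Type} (rs rf : ℕ) : Prog P := block
  [.op .mul 17 rs rs,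
   .move 7 rf, .op .div 8 20 rs, .op .add 8 8 33, .op .div 9 24 rs, readArr, .op .add 19 19 10,
   .move 7 33, .op .div 8 20 rs, .op .add 8 8 33, .op .div 9 24 rs, readArr, .move 18 10,
   .move 7 rf, .op .div 8 20 17, .op .add 8 8 33, .op .mul 8 8 rs, .op .div 9 19 17,
   .op .mul 9 9 rs, .op .mod 11 24 rs, .op .add 9 9 11, readArr, .op .mul 10 10 18,
   .op .add 19 19 10]

/-- The conditions `hy1` and `hy2` exclude overflow; they hold since a level never overshoots the
function that it stores. -/
theorem runs_readLevel {P : Type} {w : ℕ} {B C D : List Bool} {env : P → ℕ → ℕ → ℕ → Prop}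
    {st : RamState} {rs rf f n s j y : ℕ} {V F E : ℕ → ℕ} (hrs : 20 ≤ rs) (hrf : 20 ≤ rf)
    (hB : B = C ++ (levelBits f n s V F E ++ D))
    (h6 : st.reg 6 = C.length) (h19 : st.reg 19 = y) (h20 : st.reg 20 = n) (h21 : st.reg 21 = w)
    (h24 : st.reg 24 = j) (h33 : st.reg 33 = 1) (h_rs : st.reg rs = s) (h_rf : st.reg rf = f)
    (hs : 0 < s) (hf : 0 < f) (hfw : f ≤ w) (hb : C.length + levelSize f n s < 2 ^ w)
    (hn : n < 2 ^ w) (hsn : s * s ≤ n) (hjn : j ≤ n) (hF : F (j / s) ≤ 1)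
    (hy1 : y + V (j / s) % 2 ^ f ≤ n) (hy2 : levelValue f s V F E j y ≤ n) :
    Runs w B env (readLevel rs rf) st 76 fun s' =>
      s'.reg 6 = C.length + levelSize f n s ∧ s'.reg 19 = levelValue f s V F E j y ∧
      ∀ r, 20 ≤ r → s'.reg r = st.reg r := by
  have hw : 0 < w := by omega
  set y1 := y + V (j / s) % 2 ^ f with hy1d
  set e := y1 / (s * s) * s + j % s with he
  have hval : levelValue f s V F E j y = y1 + E e % 2 ^ f * F (j / s) := rfl
  rw [hval] at hy2 ⊢
  set N1 := n / s + 1 with hN1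
  set N2 := (n / (s * s) + 1) * s with hN2
  have hsize : levelSize f n s = f * N1 + 1 * N1 + f * N2 := rfl
  have hA1 : HasArr B C.length f N1 V := by
    rw [hB, levelBits, List.append_assoc]
    exact hasArr_append _ _ _ _ _
  have hA2 : HasArr B (C.length + f * N1) 1 N1 F := by
    have := hasArr_append (C ++ packArr f N1 V) (packArr f N2 E ++ D) 1 N1 F
    rw [List.length_append, length_packArr] at this
    rw [hB, levelBits]
    simpa only [List.append_assoc] using this
  have hA3 : HasArr B (C.length + f * N1 + 1 * N1) f N2 E := by
    have := hasArr_append (C ++ packArr f N1 V ++ packArr 1 N1 F) D f N2 E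
    rw [List.length_append, List.length_append, length_packArr, length_packArr] at this
    rw [hB, levelBits]
    simpa only [List.append_assoc] using this
  have hi1 : j / s < N1 := Nat.lt_succ_of_le (Nat.div_le_div_right hjn)
  have hi2 : e < N2 := by
    have h1 : y1 / (s * s) ≤ n / (s * s) := Nat.div_le_div_right hy1
    have h2 := Nat.mul_le_mul_right s h1
    have := Nat.mod_lt j hs
    rw [hN2, Nat.succ_mul]
    omega
  have hN1le : N1 ≤ f * N1 := Nat.le_mul_of_pos_left _ hf
  have hN2le : N2 ≤ f * N2 := Nat.le_mul_of_pos_left _ hf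
  have hN2' : n / (s * s) + 1 ≤ N2 := Nat.le_mul_of_pos_right _ hs
  have hEF : E e % 2 ^ f * F (j / s) ≤ n := by omega
  have hne : ∀ r, 20 ≤ r → r ≠ 6 ∧ r ≠ 7 ∧ r ≠ 8 ∧ r ≠ 9 ∧ r ≠ 10 ∧ r ≠ 11 ∧ r ≠ 17 ∧ r ≠ 18 ∧
      r ≠ 19 := fun r hr => by omega
  obtain ⟨a1, a2, a3, a4, a5, a6, a7, a8, a9⟩ := hne rs hrs
  obtain ⟨b1, b2, b3, b4, b5, b6, b7, b8, b9⟩ := hne rf hrf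
  refine .op (s * s) ?_ <| .move <| .op (n / s) ?_ <| .op N1 ?_ <| .op (j / s) ?_ <|
    runs_readArr_cons hA1 ?_ ?_ ?_ ?_ ?_ hi1 hf hfw ?_ ?_
  all_goals try simp only [RamState.reg_set, h_rs, h_rf, h6, h20, h21, h24, h33, a1, a2, a3, a4, a5,
    a6, a7, a8, a9, b1, b2, b3, b4, b5, b6, b7, b8, b9, reduceIte, Nat.reduceEqDiff]
  · exact WordOp.eval_mul (by omega)
  · exact WordOp.eval_div hn
  · exact WordOp.eval_add (by omega)
  · exact WordOp.eval_div (by omega)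
  · omega
  intro s1 h6 h10 h1
  have hr : ∀ r, 20 ≤ r → s1.reg r = st.reg r := fun r h => by
    rw [h1 r (by omega)]
    simp [show r ≠ 6 by omega, show r ≠ 7 by omega, show r ≠ 8 by omega, show r ≠ 9 by omega,
      show r ≠ 17 by omega]
  have h17 : s1.reg 17 = s * s := by rw [h1 17 le_rfl]; simp
  have h19 : s1.reg 19 = y := by rw [h1 19 (by norm_num)]; simpa using h19
  simp only [← hr 20 le_rfl, ← hr 21 (by norm_num), ← hr 24 (by norm_num), ← hr 33 (by norm_num),
    ← hr rs hrs, ← hr rf hrf] at h20 h21 h24 h33 h_rs h_rf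
  -- the sample has been read; next comes the flag
  refine .op y1 ?_ <| .move <| .op (n / s) ?_ <| .op N1 ?_ <| .op (j / s) ?_ <|
    runs_readArr_cons hA2 ?_ ?_ ?_ ?_ ?_ hi1 one_pos hw ?_ ?_
  all_goals try simp only [RamState.reg_set, h_rs, h_rf, h6, h10, h19, h20, h21, h24, h33, a1, a2,
    a3, a4, a5, a6, a7, a8, a9, b1, b2, b3, b4, b5, b6, b7, b8, b9, reduceIte, Nat.reduceEqDiff]
  · exact WordOp.eval_add (by omega)
  · exact WordOp.eval_div hn
  · exact WordOp.eval_add (by omega)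
  · exact WordOp.eval_div (by omega)
  · omega
  intro s2 h6 h10 h2
  have hr2 : ∀ r, 20 ≤ r → s2.reg r = s1.reg r := fun r h => by
    rw [h2 r (by omega)]
    simp [show r ≠ 6 by omega, show r ≠ 7 by omega, show r ≠ 8 by omega, show r ≠ 9 by omega,
      show r ≠ 19 by omega]
  replace h17 : s2.reg 17 = s * s := by rw [h2 17 le_rfl]; simpa using h17
  replace h19 : s2.reg 19 = y1 := by rw [h2 19 (by norm_num)]; simp
  rw [pow_one, Nat.mod_eq_of_lt (by omega)] at h10
  simp only [← hr2 20 le_rfl, ← hr2 21 (by norm_num), ← hr2 24 (by norm_num),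
    ← hr2 33 (by norm_num), ← hr2 rs hrs, ← hr2 rf hrf] at h20 h21 h24 h33 h_rs h_rf
  -- the slot of the exception is computed from the value `y1` found so far
  refine .move <| .move <| .op (n / (s * s)) ?_ <| .op (n / (s * s) + 1) ?_ <| .op N2 ?_ <|
    .op (y1 / (s * s)) ?_ <| .op (y1 / (s * s) * s) ?_ <| .op (j % s) ?_ <| .op e ?_ <|
    runs_readArr_cons hA3 ?_ ?_ ?_ ?_ ?_ hi2 hf hfw ?_ ?_
  all_goals try simp only [RamState.reg_set, h_rs, h_rf, h6, h10, h17, h19, h20, h21, h24, h33, a1,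
    a2, a3, a4, a5, a6, a7, a8, a9, b1, b2, b3, b4, b5, b6, b7, b8, b9, reduceIte,
    Nat.reduceEqDiff]
  · exact WordOp.eval_div hn
  · exact WordOp.eval_add (by omega)
  · exact WordOp.eval_mul (by omega)
  · exact WordOp.eval_div (by omega)
  · exact WordOp.eval_mul (by omega)
  · exact WordOp.eval_mod (by omega)
  · exact WordOp.eval_add (by omega)
  · omega
  intro s3 h6 h10 h3
  have h18 : s3.reg 18 = F (j / s) := by rw [h3 18 (by norm_num)]; simp
  replace h19 : s3.reg 19 = y1 := by rw [h3 19 (by norm_num)]; simpa using h19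
  refine .op (E e % 2 ^ f * F (j / s)) ?_ <| .op (y1 + E e % 2 ^ f * F (j / s)) ?_ <| .nil
    ⟨?_, ?_, fun r h => ?_⟩
  all_goals simp only [RamState.reg_set, h6, h10, h18, h19, reduceIte, Nat.reduceEqDiff]
  · exact WordOp.eval_mul (by omega)
  · exact WordOp.eval_add (by omega)
  · rw [hsize]; ring
  · rw [h3 r (by omega), ← hr r h, ← hr2 r h]
    simp [show r ≠ 7 by omega, show r ≠ 8 by omega, show r ≠ 9 by omega, show r ≠ 10 by omega,
      show r ≠ 11 by omega, show r ≠ 18 by omega, show r ≠ 19 by omega]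

/-! ### Two levels determine a monotone function up to a small error -/

open scoped Classical in
/-- The flags of the upper level, which mark the sparse blocks. -/
noncomputable def upperFlags (I : ℕ → ℕ) (s u : ℕ) : ℕ := if Sparse I s u then 1 else 0

open scoped Classical in
/-- The samples of the lower level, relative to the start of the upper block. They are zero in the
sparse upper blocks, where the upper level is exact. -/
noncomputable def lowerSamples (I : ℕ → ℕ) (s k q : ℕ) : ℕ :=
  if Sparse I s (q * k / s) then 0 else I (q * k) - I (q * k / s * s)

open scoped Classical in
/-- The flags of the lower level, which mark the sparse lower blocks in the other upper blocks. -/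
noncomputable def lowerFlags (I : ℕ → ℕ) (s k q : ℕ) : ℕ :=
  if ¬ Sparse I s (q * k / s) ∧ Sparse I k q then 1 else 0

/-- The upper level of the structure, with samples for blocks of `s` positions. -/
noncomputable def upperBits (f n s : ℕ) (I : ℕ → ℕ) : List Bool :=
  levelBits f n s (fun u => I (u * s)) (upperFlags I s) (exceptions I s)

/-- The lower level of the structure, with samples for blocks of `k` positions. -/
noncomputable def lowerBits (f n s k : ℕ) (I : ℕ → ℕ) : List Bool :=
  levelBits f n k (lowerSamples I s k) (lowerFlags I s k) (exceptions I k)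

open scoped Classical in
/-- What the upper level tells about `I j`. -/
noncomputable def upperValue (I : ℕ → ℕ) (s j : ℕ) : ℕ :=
  if Sparse I s (j / s) then I j else I (j / s * s)

open scoped Classical in
/-- What both levels together tell about `I j`. -/
noncomputable def lowerValue (I : ℕ → ℕ) (s k j : ℕ) : ℕ :=
  if Sparse I s (j / s) ∨ Sparse I k (j / k) then I j else I (j / k * k)

theorem le_of_div_mul {I : ℕ → ℕ} (hI : Monotone I) (s j : ℕ) : I (j / s * s) ≤ I j :=
  hI (Nat.div_mul_le_self j s)

theorem lt_of_not_sparse {I : ℕ → ℕ} (hI : Monotone I) {s j : ℕ} (hs : 0 < s)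
    (h : ¬ Sparse I s (j / s)) : I j < I (j / s * s) + s * s := by
  refine lt_of_le_of_lt (hI ?_) (not_le.1 h)
  rw [Nat.succ_mul]
  exact (Nat.lt_div_mul_add hs).le

theorem upperValue_le {I : ℕ → ℕ} (hI : Monotone I) (s j : ℕ) : upperValue I s j ≤ I j := by
  unfold upperValue
  split_ifs
  · exact le_rfl
  · exact le_of_div_mul hI s j

theorem lowerValue_le {I : ℕ → ℕ} (hI : Monotone I) (s k j : ℕ) : lowerValue I s k j ≤ I j := by
  unfold lowerValue
  split_ifs
  · exact le_rfl
  · exact le_of_div_mul hI k j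

theorem le_lowerValue_add {I : ℕ → ℕ} (hI : Monotone I) {s k : ℕ} (hk : 0 < k) (j : ℕ) :
    I j ≤ lowerValue I s k j + k * k := by
  unfold lowerValue
  split_ifs with h
  · omega
  · exact (lt_of_not_sparse hI hk fun h' => h (.inr h')).le

theorem levelValue_upper {I : ℕ → ℕ} (hI : Monotone I) {f s : ℕ} (hs : 0 < s)
    (hIf : ∀ j, I j < 2 ^ f) (j : ℕ) :
    levelValue f s (fun u => I (u * s)) (upperFlags I s) (exceptions I s) j 0 =
      upperValue I s j := by
  have hle := le_of_div_mul hI s j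
  rw [levelValue, zero_add, Nat.mod_eq_of_lt (hIf _)]
  unfold upperFlags upperValue
  split_ifs with h
  · rw [exceptions_eq hI hs h, Nat.mod_eq_of_lt ((Nat.sub_le _ _).trans_lt (hIf j))]
    omega
  · omega

theorem div_mul_div_of_dvd {k s : ℕ} (hk : 0 < k) (hks : k ∣ s) (j : ℕ) :
    j / k * k / s = j / s := by
  obtain ⟨m, rfl⟩ := hks
  rw [← Nat.div_div_eq_div_mul, ← Nat.div_div_eq_div_mul, Nat.mul_div_cancel _ hk]

open scoped Classical in
/-- The samples of the lower level refine what the upper level tells to the start of the lower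
block; relative values fit into `f` bits outside the sparse upper blocks. -/
theorem upperValue_add_lowerSamples {I : ℕ → ℕ} (hI : Monotone I) {f s k : ℕ} (hs : 0 < s)
    (hk : 0 < k) (hks : k ∣ s) (hf : s * s ≤ 2 ^ f) (j : ℕ) :
    upperValue I s j + lowerSamples I s k (j / k) % 2 ^ f =
      if Sparse I s (j / s) then I j else I (j / k * k) := by
  have hd := div_mul_div_of_dvd hk hks j
  unfold upperValue lowerSamples
  rw [hd]
  split_ifs with h
  · simp
  · have h1 := lt_of_not_sparse hI hs h
    have h2 := le_of_div_mul hI k j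
    have h3 := le_of_div_mul hI s (j / k * k)
    rw [hd] at h3
    rw [Nat.mod_eq_of_lt (by omega)]
    omega

theorem levelValue_lower {I : ℕ → ℕ} (hI : Monotone I) {f s k : ℕ} (hs : 0 < s)
    (hk : 0 < k) (hks : k ∣ s) (hf : s * s ≤ 2 ^ f) (j : ℕ) :
    levelValue f k (lowerSamples I s k) (lowerFlags I s k) (exceptions I k) j (upperValue I s j) =
      lowerValue I s k j := by
  have hd := div_mul_div_of_dvd hk hks j
  rw [levelValue, upperValue_add_lowerSamples hI hs hk hks hf]
  unfold lowerFlags lowerValue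
  rw [hd]
  by_cases h : Sparse I s (j / s)
  · simp [h]
  · by_cases h' : Sparse I k (j / k)
    · have h1 := lt_of_not_sparse hI hs h
      have h2 := le_of_div_mul hI k j
      have h3 := le_of_div_mul hI s (j / k * k)
      rw [hd] at h3
      simp only [h, h', if_false, or_true, if_true, not_false_eq_true, and_self]
      rw [exceptions_eq hI hk h', Nat.mod_eq_of_lt (by omega)]
      omega
    · simp [h, h']

/-! ### The parameters of the structure -/

/-- The least `a` such that numbers up to `n` have at most `2 ^ (M * a)` binary digits; thus
`2 ^ a` is about the `M`-th root of `log n`. -/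
noncomputable def rootExp (M n : ℕ) : ℕ := sInf {a | n < 2 ^ 2 ^ (M * a)}

theorem lt_rootExp {M : ℕ} (hM : 0 < M) (n : ℕ) : n < 2 ^ 2 ^ (M * rootExp M n) := by
  have hne : {a | n < 2 ^ 2 ^ (M * a)}.Nonempty := by
    refine ⟨n, ?_⟩
    have h1 : n < 2 ^ n := Nat.lt_two_pow_self
    have h2 : n ≤ 2 ^ (M * n) :=
      h1.le.trans (Nat.pow_le_pow_right two_pos (Nat.le_mul_of_pos_left _ hM))
    exact h1.trans_le (Nat.pow_le_pow_right two_pos h2)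
  exact Nat.sInf_mem hne

theorem le_of_lt_rootExp {M n i : ℕ} (h : i < rootExp M n) : 2 ^ 2 ^ (M * i) ≤ n :=
  not_lt.1 fun h' => (Nat.sInf_le (show i ∈ {a | n < 2 ^ 2 ^ (M * a)} from h')).not_gt h

/-- The polylogarithmic size `X`, at least the number of binary digits of `n`. -/
noncomputable def digitBound (M n : ℕ) : ℕ := 2 ^ (M * rootExp M n)

/-- The number of bits of the whole structure; the bit in front of the levels says that they are
there. -/
noncomputable def totalSize (M n : ℕ) : ℕ :=
  1 + levelSize (digitBound M n) n (digitBound M n * digitBound M n) +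
    levelSize (4 * M * rootExp M n) n (2 ^ rootExp M n)

/-- The lengths for which the structure is stored: it has at most `n` bits, so that all addresses
fit into a word, and so do the parameters. -/
def IsLarge (M n : ℕ) : Prop :=
  2 ≤ n ∧ 4 * M ≤ n ∧ 2 ^ (4 * M * rootExp M n) ≤ n ∧ totalSize M n ≤ n

open scoped Classical in
/-- The bits that are stored for a text, with word width `w`. Nothing is stored for short texts. -/
noncomputable def lcpBits (M w : ℕ) (T : List ℕ) : List Bool :=
  if IsLarge M T.length then
    [true] ++ (upperBits (min (digitBound M T.length) w) T.length
        (digitBound M T.length * digitBound M T.length) (lcpProfile T) ++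
      (lowerBits (4 * M * rootExp M T.length) T.length
        (digitBound M T.length * digitBound M T.length) (2 ^ rootExp M T.length)
        (lcpProfile T) ++ []))
  else []

theorem levelSize_mono {f f' : ℕ} (h : f ≤ f') (n s : ℕ) : levelSize f n s ≤ levelSize f' n s := by
  unfold levelSize
  gcongr

theorem length_lcpBits_le (M w : ℕ) (T : List ℕ) :
    (lcpBits M w T).length ≤ totalSize M T.length := by
  unfold lcpBits
  split_ifs
  · have := levelSize_mono (min_le_left (digitBound M T.length) w) T.length
      (digitBound M T.length * digitBound M T.length)
    simp only [List.length_append, upperBits, lowerBits, length_levelBits, List.length_nil,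
      List.length_singleton, totalSize]
    omega
  · simp

/-! ### The computation of the parameters -/

/-- With `n` in register `20` and `w` in `21`, compute `X` in register `25`, the lower block length
`k = 2 ^ a` in `26`, the lower width `4 * M * a` in `27`, the upper width `min X w` in `28` and the
upper block length `X ^ 2` in `29`. -/
def setup {P : Type} (M : ℕ) : Prog P := block
  [.const 25 1, .const 26 1, .const 27 0, .const 11 M, .const 12 (4 * M), .op .shr 10 20 25,
   .loop 10 (block [.op .shl 25 25 11, .op .add 26 26 26, .op .add 27 27 12, .op .shr 10 20 25]),
   .op .lt 10 21 25, .ite 10 (block [.move 28 21]) (block [.move 28 25]), .op .mul 29 25 25]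

/-- The loop multiplies `X` by `2 ^ M` until `n` has at most `X` binary digits. -/
theorem runs_setup {P : Type} {w M n : ℕ} {B : List Bool} {env : P → ℕ → ℕ → ℕ → Prop}
    {st : RamState} (hM : 0 < M) (h20 : st.reg 20 = n) (h21 : st.reg 21 = w) (hn : n < 2 ^ w)
    (hlarge : IsLarge M n) :
    Runs w B env (setup M) st (6 * rootExp M n + 14) fun s' =>
      s'.reg 26 = 2 ^ rootExp M n ∧ s'.reg 27 = 4 * M * rootExp M n ∧
      s'.reg 28 = min (digitBound M n) w ∧ s'.reg 29 = digitBound M n * digitBound M n ∧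
      ∀ r, r ∉ [10, 11, 12, 25, 26, 27, 28, 29] → s'.reg r = st.reg r := by
  obtain ⟨hn2, h4M, hX4, -⟩ := hlarge
  have hw : 0 < w := by
    rcases Nat.eq_zero_or_pos w with rfl | h
    · omega
    · exact h
  have h1 : 1 < 2 ^ w := by omega
  have hc : 4 * M * rootExp M n < n := Nat.lt_two_pow_self.trans_le hX4
  have hXX : digitBound M n * digitBound M n ≤ n := by
    refine le_trans ?_ hX4
    rw [digitBound, ← pow_add]
    exact Nat.pow_le_pow_right two_pos (by rw [mul_assoc]; omega)
  have hX : digitBound M n ≤ n :=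
    (Nat.le_mul_of_pos_left _ (by unfold digitBound; positivity)).trans hXX
  set a := rootExp M n with ha
  set X := digitBound M n with hXdef
  -- the parameters after `i` rounds are those for the exponent `i`
  let Inv : ℕ → RamState → Prop := fun m s => ∃ i, i + m = a ∧ s.reg 25 = 2 ^ (M * i) ∧
    s.reg 26 = 2 ^ i ∧ s.reg 27 = 4 * M * i ∧ s.reg 10 = n / 2 ^ 2 ^ (M * i) ∧ s.reg 11 = M ∧
    s.reg 12 = 4 * M ∧ ∀ r, r ∉ [10, 11, 12, 25, 26, 27, 28, 29] → s.reg r = st.reg r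
  have hmono : ∀ i, i ≤ a → 2 ^ (M * i) ≤ X := fun i hi =>
    Nat.pow_le_pow_right two_pos (Nat.mul_le_mul_left _ hi)
  refine .const h1 <| .const h1 <| .const (by omega) <| .const (by omega) <| .const (by omega) <|
    .op (n / 2 ^ 1) ?_ <| .cons' (M := 6) (Runs.loop (K := 5) (Q := Inv 0) Inv ?_ ?_ a _ ?_)
    (by omega) ?_
  · simp only [RamState.reg_set, h20, reduceIte, Nat.reduceEqDiff]
    exact WordOp.eval_shr hn
  · rintro m s ⟨i, him, h25, h26, h27, h10, h11, h12, hr⟩ hne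
    have hia : i < a := by
      rcases Nat.lt_or_ge i a with h | h
      · exact h
      · rw [h10, show i = a by omega, Nat.div_eq_of_lt (lt_rootExp hM n)] at hne
        exact absurd rfl hne
    have hs20 := hr 20 (by simp)
    rw [h20] at hs20
    refine ⟨m - 1, by omega, ?_⟩
    have e1 : 2 ^ (M * i) * 2 ^ M = 2 ^ (M * (i + 1)) := by rw [Nat.mul_succ, pow_add]
    have e2 : 2 ^ i + 2 ^ i = 2 ^ (i + 1) := by rw [pow_succ, mul_two]
    have e3 : 4 * M * i + 4 * M = 4 * M * (i + 1) := by rw [Nat.mul_succ]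
    have b1 : 2 ^ (M * (i + 1)) ≤ X := hmono _ hia
    have b2 : 2 ^ (i + 1) ≤ 2 ^ (M * (i + 1)) :=
      Nat.pow_le_pow_right two_pos (Nat.le_mul_of_pos_left _ hM)
    have b3 : 4 * M * (i + 1) ≤ 4 * M * a := Nat.mul_le_mul_left _ hia
    refine .op (2 ^ (M * (i + 1))) ?_ <| .op (2 ^ (i + 1)) ?_ <| .op (4 * M * (i + 1)) ?_ <|
      .op (n / 2 ^ 2 ^ (M * (i + 1))) ?_ <| .nil ⟨i + 1, by omega, ?_, ?_, ?_, ?_, ?_, ?_, ?_⟩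
    all_goals simp only [RamState.reg_set, h25, h26, h27, h11, h12, hs20, reduceIte,
      Nat.reduceEqDiff]
    · rw [WordOp.eval_shl (by omega), e1]
    · rw [WordOp.eval_add (by omega), e2]
    · rw [WordOp.eval_add (by omega), e3]
    · exact WordOp.eval_shr hn
    · intro r h
      rw [← hr r h]
      simp only [List.mem_cons, not_or] at h
      simp [h]
  · rintro m s ⟨i, him, h25, h26, h27, h10, hrest⟩ h0
    have hia : ¬ i < a := by
      intro h
      have := le_of_lt_rootExp h
      rw [h10] at h0
      exact (Nat.div_pos this (by positivity)).ne' h0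
    exact ⟨i, by omega, h25, h26, h27, h10, hrest⟩
  · refine ⟨0, by omega, ?_, ?_, ?_, ?_, ?_, ?_, ?_⟩
    all_goals simp only [RamState.reg_set, reduceIte, Nat.reduceEqDiff, mul_zero, pow_zero]
    intro r h
    simp only [List.mem_cons, not_or] at h
    simp [h]
  rintro s1 ⟨i, hi, h25, h26, h27, -, -, -, hr⟩
  obtain rfl : i = a := by omega
  have hs20 := hr 20 (by simp)
  have hs21 := hr 21 (by simp)
  rw [h20] at hs20
  rw [h21] at hs21
  have h25' : s1.reg 25 = X := h25
  refine .op (if w < X then 1 else 0) ?_ <| .cons' (K := 3) (M := 2) (Q' := fun s2 =>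
    s2 = (s1.set 10 (if w < X then 1 else 0)).set 28 (min X w)) (.ite ?_ ?_) (by omega) ?_
  · rw [hs21, h25']
    exact WordOp.eval_lt hw
  · intro h
    have hlt : w < X := by
      by_contra h'
      simp [RamState.reg_set, h'] at h
    refine .move <| .nil ?_
    simp [RamState.reg_set, hs21, hlt.le]
  · intro h
    have hle : X ≤ w := by
      by_contra! h'
      simp [RamState.reg_set, h'] at h
    refine .move <| .nil ?_
    simp [RamState.reg_set, h25', hle]
  · rintro s2 rfl
    refine .op (X * X) ?_ <| .nil ⟨?_, ?_, ?_, ?_, ?_⟩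
    all_goals simp only [RamState.reg_set, h25', h26, h27, reduceIte, Nat.reduceEqDiff]
    · exact WordOp.eval_mul (by omega)
    · intro r h
      rw [← hr r h]
      simp only [List.mem_cons, not_or] at h
      simp [h]

/-! ### The lookup of a lower bound and the comparison of two suffixes -/

/-- Put a lower bound for the value of position `reg 24` of the monotone function into
register `19`, which is zero before. -/
def lookup {P : Type} (M : ℕ) : Prog P := block
  [setup M, .const 6 1, readLevel 29 28, readLevel 26 27]

/-- The registers `25` to `29` hold the parameters, and no address exceeds the size of the
structure, so that all arithmetic is exact. -/
theorem runs_lookup {P : Type} {w M j : ℕ} {T : List ℕ} {env : P → ℕ → ℕ → ℕ → Prop}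
    {st : RamState} (hM : 0 < M) (hlarge : IsLarge M T.length) (hn : T.length < 2 ^ w)
    (h19 : st.reg 19 = 0) (h20 : st.reg 20 = T.length) (h21 : st.reg 21 = w)
    (h24 : st.reg 24 = j) (h33 : st.reg 33 = 1) (hj : j ≤ T.length) :
    Runs w (lcpBits M w T) env (lookup M) st (6 * rootExp M T.length + 168) fun s' =>
      s'.reg 19 ≤ lcpProfile T j ∧
      lcpProfile T j ≤ s'.reg 19 + 2 ^ rootExp M T.length * 2 ^ rootExp M T.length ∧
      ∀ r, 20 ≤ r → r ∉ [25, 26, 27, 28, 29] → s'.reg r = st.reg r := by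
  set n := T.length with hnT
  have hI := lcpProfile_mono T
  have hIn : ∀ i, lcpProfile T i ≤ n := lcpProfile_le T
  set I := lcpProfile T with hId
  set a := rootExp M n with ha
  set X := digitBound M n with hX
  have hl := hlarge
  obtain ⟨hn2, h4M, hX4, htot⟩ := hl
  have hw : 0 < w := by
    rcases Nat.eq_zero_or_pos w with rfl | h
    · omega
    · exact h
  have ha0 : 0 < a := by
    rcases Nat.eq_zero_or_pos a with h | h
    · have := lt_rootExp hM n
      rw [← ha, h] at this
      simp at this
      omega
    · exact h
  have hX0 : 0 < X := by rw [hX, digitBound]; positivity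
  have hk0 : 0 < 2 ^ a := by positivity
  have hkX : 2 ^ a ≤ X := Nat.pow_le_pow_right two_pos (Nat.le_mul_of_pos_left _ hM)
  have hks : 2 ^ a ∣ X * X :=
    (Nat.pow_dvd_pow 2 (Nat.le_mul_of_pos_left a hM)).trans (Dvd.intro X rfl)
  have hs4 : X * X * (X * X) = 2 ^ (4 * M * a) := by
    rw [hX, digitBound, ← pow_add, ← pow_add]
    congr 1
    ring
  have hss : X * X * (X * X) ≤ n := hs4.trans_le hX4
  have hs0 : 0 < X * X := Nat.mul_pos hX0 hX0
  have hsn : X * X ≤ n := (Nat.le_mul_of_pos_left _ hs0).trans hss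
  have hkk : 2 ^ a * 2 ^ a ≤ n := (Nat.mul_le_mul hkX hkX).trans hsn
  have hcw : 4 * M * a ≤ w :=
    ((Nat.pow_lt_pow_iff_right one_lt_two).1 (hX4.trans_lt hn)).le
  have hIf : ∀ i, I i < 2 ^ min X w := by
    intro i
    refine (hIn i).trans_lt ?_
    rcases min_choice X w with h | h <;> rw [h]
    · exact lt_rootExp hM n
    · exact hn
  have htot' : 1 + levelSize (min X w) n (X * X) + levelSize (4 * M * a) n (2 ^ a) ≤ n := by
    have := levelSize_mono (min_le_left X w) n (X * X)
    have : 1 + levelSize X n (X * X) + levelSize (4 * M * a) n (2 ^ a) ≤ n := htot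
    omega
  have hB : lcpBits M w T = [true] ++ (upperBits (min X w) n (X * X) I ++
      (lowerBits (4 * M * a) n (X * X) (2 ^ a) I ++ [])) := if_pos hlarge
  have hv1 := levelValue_upper hI hs0 hIf j
  have hc2 : X * X * (X * X) ≤ 2 ^ (4 * M * a) := hs4.le
  have hv2 := levelValue_lower hI hs0 hk0 hks hc2 j
  refine .cons' (M := 154) (runs_setup hM h20 h21 hn hlarge) (by omega) ?_
  rintro s1 ⟨g26, g27, g28, g29, hr⟩
  rw [← ha] at g26 g27
  rw [← hX] at g28 g29
  have g19 : s1.reg 19 = 0 := by rw [hr 19 (by simp), h19]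
  have g20 : s1.reg 20 = n := by rw [hr 20 (by simp), h20]
  have g21 : s1.reg 21 = w := by rw [hr 21 (by simp), h21]
  have g24 : s1.reg 24 = j := by rw [hr 24 (by simp), h24]
  have g33 : s1.reg 33 = 1 := by rw [hr 33 (by simp), h33]
  refine .const (by omega) <| .cons' (M := 77) (runs_readLevel (rs := 29) (rf := 28) (n := n)
    (j := j) (y := 0) (s := X * X) (f := min X w) (C := [true])
    (by norm_num) (by norm_num) hB ?_ ?_ ?_ ?_ ?_ ?_ ?_ ?_ hs0 (by omega) (min_le_right _ _) ?_ hn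
    hss hj ?_ ?_ ?_) (by omega) ?_
  all_goals try simp only [RamState.reg_set, g19, g20, g21, g24, g28, g29, g33, reduceIte,
    Nat.reduceEqDiff, List.length_singleton]
  · omega
  · unfold upperFlags; split_ifs <;> omega
  · rw [zero_add, Nat.mod_eq_of_lt (hIf _)]; exact hIn _
  · rw [hv1]; exact (upperValue_le hI _ _).trans (hIn _)
  rintro s2 ⟨k6, k19, hr2⟩
  rw [hv1] at k19
  have hrs : ∀ r, 20 ≤ r → s2.reg r = s1.reg r := fun r h => by
    rw [hr2 r h]; simp [RamState.reg_set, show r ≠ 6 by omega]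
  have hB' : lcpBits M w T = ([true] ++ upperBits (min X w) n (X * X) I) ++
      (lowerBits (4 * M * a) n (X * X) (2 ^ a) I ++ []) := by rw [hB, List.append_assoc]
  have hlen : ([true] ++ upperBits (min X w) n (X * X) I).length =
      1 + levelSize (min X w) n (X * X) := by
    rw [List.length_append, upperBits, length_levelBits, List.length_singleton]
  have hmid := upperValue_add_lowerSamples hI hs0 hk0 hks hc2 j
  refine .cons' (M := 1) (runs_readLevel (rs := 26) (rf := 27) (n := n)
    (j := j) (y := upperValue I (X * X) j) (s := 2 ^ a) (f := 4 * M * a)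
    (by norm_num) (by norm_num) hB' ?_ k19 ?_ ?_ ?_ ?_ ?_ ?_ hk0 (by positivity) hcw ?_ hn
    hkk hj ?_ ?_ ?_) (by omega) ?_
  · rw [hlen, k6]
  iterate 6 rw [hrs _ (by norm_num)]; assumption
  · rw [hlen]; omega
  · unfold lowerFlags; split_ifs <;> omega
  · rw [hmid]; split_ifs
    · exact hIn _
    · exact hIn _
  · rw [hv2]; exact (lowerValue_le hI _ _ _).trans (hIn _)
  rintro s3 ⟨-, m19, hr3⟩
  rw [hv2] at m19
  refine .nil ⟨?_, ?_, ?_⟩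
  · rw [m19]; exact lowerValue_le hI _ _ _
  · rw [m19]; exact le_lowerValue_add hI hk0 j
  · intro r h h'
    rw [hr3 r h, hrs r h, hr r]
    simp only [List.mem_cons, not_or] at h' ⊢
    simp [h']
    omega

/-- Decide whether the match of length `reg 0` between the suffixes at positions `reg 22` and
`reg 23` extends by one character. The lengths of the suffixes are in registers `25` and `26`. The
answer goes to register `10`. -/
def testNext : Prog SAProc := block
  [.op .lt 10 0 25, .op .lt 11 0 26, .op .and 10 10 11,
   .ite 10 (block [.op .add 11 22 0, .call .char 11 11, .op .add 12 23 0, .call .char 12 12,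
     .op .eq 10 11 12]) (block [])]

/-- The registers that stay as they are during the comparison of two suffixes. -/
structure Comparing (T : List ℕ) (p q : ℕ) (s : RamState) : Prop where
  h22 : s.reg 22 = p
  h23 : s.reg 23 = q
  h25 : s.reg 25 = T.length - (p - 1)
  h26 : s.reg 26 = T.length - (q - 1)
  h33 : s.reg 33 = 1

theorem runs_testNext {w tC p q l : ℕ} {B : List Bool} {T : List ℕ}
    {env : SAProc → ℕ → ℕ → ℕ → Prop} {st : RamState}
    (hchar : ∀ i, 1 ≤ i → i ≤ T.length → ∃ k ≤ tC, env .char i (textChar T i) k)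
    (hn : T.length < 2 ^ w) (hp : 1 ≤ p) (hq : 1 ≤ q) (hp' : p ≤ T.length)
    (hst : Comparing T p q st) (h0 : st.reg 0 = l) (hl : l ≤ lcpLength T p q) :
    Runs w B env testNext st (2 * tC + 11) fun s' => Comparing T p q s' ∧ s'.reg 0 = l ∧
      s'.reg 10 = if l < lcpLength T p q then 1 else 0 := by
  have hw : 0 < w := by
    rcases Nat.eq_zero_or_pos w with rfl | h
    · omega
    · exact h
  have h1 : 1 < 2 ^ w := Nat.one_lt_two_pow hw.ne'
  obtain ⟨h22, h23, h25, h26, h33⟩ := hst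
  have hiff := lt_lcpLength_iff T hp hq hl
  set b : ℕ := if l < T.length - (p - 1) ∧ l < T.length - (q - 1) then 1 else 0 with hb
  refine .op (if l < T.length - (p - 1) then 1 else 0) ?_ <|
    .op (if l < T.length - (q - 1) then 1 else 0) ?_ <|
    .op b ?_ <| .cons' (K := 2 * tC + 7) (M := 1) (Q' := fun s' => Comparing T p q s' ∧
      s'.reg 0 = l ∧ s'.reg 10 = if l < lcpLength T p q then 1 else 0) (.ite ?_ ?_) (by omega)
      fun s' h => .nil h
  · rw [h0, h25]; exact WordOp.eval_lt hw
  · simp only [RamState.reg_set, h0, h26, reduceIte, Nat.reduceEqDiff]; exact WordOp.eval_lt hw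
  · simp only [RamState.reg_set, reduceIte, Nat.reduceEqDiff, WordOp.eval, hb]
    by_cases c1 : l < T.length - (p - 1) <;> by_cases c2 : l < T.length - (q - 1) <;>
      simp [c1, c2, Nat.mod_eq_of_lt h1]
  · intro hne
    have hc : l < T.length - (p - 1) ∧ l < T.length - (q - 1) := by
      by_contra hc
      simp [RamState.reg_set, hb, hc] at hne
    refine .mono (.op (p + l) ?_ <| .call (textChar T (p + l)) tC ?_ <| .op (q + l) ?_ <|
      .call (textChar T (q + l)) tC ?_ <|
      .op (if textChar T (p + l) = textChar T (q + l) then 1 else 0) ?_ <|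
      .nil ⟨⟨?_, ?_, ?_, ?_, ?_⟩, ?_, ?_⟩) (by omega) fun _ h => h
    all_goals simp only [RamState.reg_set, h0, h22, h23, h25, h26, h33, reduceIte,
      Nat.reduceEqDiff]
    · exact WordOp.eval_add (by omega)
    · exact hchar _ (by omega) (by omega)
    · exact WordOp.eval_add (by omega)
    · exact hchar _ (by omega) (by omega)
    · exact WordOp.eval_eq hw
    · simp [hiff, hc]
  · intro h0'
    have hc : ¬ (l < T.length - (p - 1) ∧ l < T.length - (q - 1)) := by
      intro hc
      simp [RamState.reg_set, hb, hc] at h0'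
    refine .mono (.nil ⟨⟨?_, ?_, ?_, ?_, ?_⟩, ?_, ?_⟩) (by omega) fun _ h => h
    all_goals simp only [RamState.reg_set, h0, h22, h23, h25, h26, h33, reduceIte,
      Nat.reduceEqDiff]
    simp [hiff, hc, hb]

/-- Extend a match of length `reg 0` character by character. -/
def scan : Prog SAProc := block [testNext, .loop 10 (block [.op .add 0 0 33, testNext])]

/-- Starting from a certain match length `l`, the scan costs two character accesses for each of
the at most `g` missing characters, and two for the mismatch. -/
theorem runs_scan {w tC p q l g : ℕ} {B : List Bool} {T : List ℕ}
    {env : SAProc → ℕ → ℕ → ℕ → Prop} {st : RamState}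
    (hchar : ∀ i, 1 ≤ i → i ≤ T.length → ∃ k ≤ tC, env .char i (textChar T i) k)
    (hn : T.length < 2 ^ w) (hp : 1 ≤ p) (hq : 1 ≤ q) (hp' : p ≤ T.length)
    (hst : Comparing T p q st) (h0 : st.reg 0 = l) (hl : l ≤ lcpLength T p q)
    (hg : lcpLength T p q ≤ l + g) :
    Runs w B env scan st ((g + 1) * (2 * tC + 14)) fun s' => s'.reg 0 = lcpLength T p q := by
  let Inv : ℕ → RamState → Prop := fun m s => Comparing T p q s ∧
    ∃ l', s.reg 0 = l' ∧ l' ≤ lcpLength T p q ∧ lcpLength T p q ≤ l' + m ∧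
      s.reg 10 = if l' < lcpLength T p q then 1 else 0
  refine .cons' (M := g * (2 * tC + 14) + 2)
    (runs_testNext hchar hn hp hq hp' hst h0 hl) (by rw [Nat.add_one_mul g]; omega) ?_
  rintro s1 ⟨hc, h0, h10⟩
  refine .cons' (M := 1) (Q' := fun s' => s'.reg 0 = lcpLength T p q)
    (Runs.loop (K := 2 * tC + 13) Inv ?_ ?_ g s1 ?_) le_rfl fun s' h => .nil h
  · rintro m s ⟨hc, l', h0, hl', hlm, h10⟩ hne
    have hlt : l' < lcpLength T p q := by
      by_contra h
      simp [h10, h] at hne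
    have hle : lcpLength T p q ≤ T.length := Nat.findGreatest_le _
    refine ⟨m - 1, by omega, .op (l' + 1) ?_ <| .cons' (M := 1)
      (runs_testNext hchar hn hp hq hp' ⟨?_, ?_, ?_, ?_, ?_⟩ ?_ hlt) (by omega) ?_⟩
    · rw [h0, hc.h33]; exact WordOp.eval_add (by omega)
    iterate 6
      simp only [RamState.reg_set, hc.h22, hc.h23, hc.h25, hc.h26, hc.h33, reduceIte,
        Nat.reduceEqDiff]
    · rintro s' ⟨hc', h0', h10'⟩
      exact .nil ⟨hc', l' + 1, h0', hlt, by omega, h10'⟩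
  · rintro m s ⟨-, l', h0, hl', -, h10⟩ h
    have : ¬ l' < lcpLength T p q := by
      intro h'
      simp [h10, h'] at h
    omega
  · exact ⟨hc, l, h0, hl, hg, h10⟩

/-! ### The query program -/

theorem packedWord_nil (w a : ℕ) : packedWord w [] a = 0 :=
  Nat.eq_of_testBit_eq fun t => by simp [testBit_packedWord]

theorem packedWord_true_ne_zero {w : ℕ} (hw : 0 < w) (B : List Bool) :
    packedWord w ([true] ++ B) 0 ≠ 0 := by
  intro h
  have := testBit_packedWord w ([true] ++ B) 0 0
  rw [h] at this
  simp [hw] at this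

/-- The query for `reg 0 > 1`: get the two neighbours in the suffix array, look up a lower bound
for the length of their match if the structure is there, and compare the rest. Registers `20`, `21`
and `33` hold `n`, `w` and `1`; the positions go to registers `22` and `23`, the zero-based second
position to `24`, and the lower bound is looked up in `19`. -/
def neighbourQuery (M : ℕ) : Prog SAProc := block
  [.call .entry 23 0, .op .sub 11 0 33, .call .entry 22 11, .op .sub 24 23 33, .const 19 0,
   .const 6 0, .read 10 6, .ite 10 (lookup M) (block []),
   .op .lt 10 24 19, .const 0 0, .ite 10 (block [.op .sub 0 19 24]) (block []),
   .op .sub 10 22 33, .op .sub 25 20 10, .op .sub 26 20 24, scan]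

open scoped Classical in
/-- A bound for the number of characters that a query has to compare successfully. -/
noncomputable def gapBound (M n : ℕ) : ℕ :=
  if IsLarge M n then 2 ^ rootExp M n * 2 ^ rootExp M n else n

theorem runs_neighbourQuery {w M tA tC i : ℕ} {T : List ℕ} {env : SAProc → ℕ → ℕ → ℕ → Prop}
    {st : RamState} (hM : 0 < M)
    (hentry : ∀ i, 1 ≤ i → i ≤ T.length → ∃ k ≤ tA, env .entry i (saEntry T i) k)
    (hchar : ∀ i, 1 ≤ i → i ≤ T.length → ∃ k ≤ tC, env .char i (textChar T i) k)
    (hn : T.length < 2 ^ w) (hi1 : 1 < i) (hin : i ≤ T.length)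
    (h0 : st.reg 0 = i) (h20 : st.reg 20 = T.length) (h21 : st.reg 21 = w) (h33 : st.reg 33 = 1) :
    Runs w (lcpBits M w T) env (neighbourQuery M) st
      (2 * tA + 6 * rootExp M T.length + 200 + (gapBound M T.length + 1) * (2 * tC + 14))
      fun s' => s'.reg 0 = lcpEntry T i := by
  have hw : 0 < w := by
    rcases Nat.eq_zero_or_pos w with rfl | h
    · omega
    · exact h
  obtain ⟨hq1, hqn⟩ := saEntry_mem T hi1.le hin
  obtain ⟨hp1, hpn⟩ := saEntry_mem T (i := i - 1) (by omega) (by omega)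
  have hprof := lcpProfile_saEntry T hi1.le hin
  have hH : lcpEntry T i = lcpLength T (saEntry T (i - 1)) (saEntry T i) := if_neg (by omega)
  have hproc := lcpProfile_le T (saEntry T i - 1)
  rw [hH] at hprof ⊢
  set q := saEntry T i with hq
  set p := saEntry T (i - 1) with hp
  refine .mono (.call q tA ?_ <| .op (i - 1) ?_ <| .call p tA ?_ <| .op (q - 1) ?_ <|
    .const (by omega) <| .const (by omega) <| .read 0 ?_ <|
    .cons' (K := 6 * rootExp M T.length + 168 + 1)
      (M := (gapBound M T.length + 1) * (2 * tC + 14) + 10) (Q' := fun s =>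
      ∃ y, s.reg 19 = y ∧ y ≤ lcpProfile T (q - 1) ∧
        lcpProfile T (q - 1) ≤ (y - (q - 1)) + (q - 1) + gapBound M T.length ∧
        s.reg 20 = T.length ∧ s.reg 22 = p ∧ s.reg 23 = q ∧ s.reg 24 = q - 1 ∧ s.reg 33 = 1)
      (.ite (K := 6 * rootExp M T.length + 168) ?_ ?_) le_rfl ?_) (by omega) fun _ h => h
  all_goals try simp only [RamState.reg_set, h0, h20, h21, h33, reduceIte, Nat.reduceEqDiff]
  · exact hentry i hi1.le hin
  · exact WordOp.eval_sub (by omega) (by omega)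
  · exact hentry _ (by omega) (by omega)
  · exact WordOp.eval_sub (by omega) (by omega)
  · intro hne
    have hl : IsLarge M T.length := by
      by_contra h
      rw [lcpBits, if_neg h, packedWord_nil] at hne
      exact hne rfl
    refine .mono (runs_lookup (j := q - 1) hM hl hn ?_ ?_ ?_ ?_ ?_ (by omega)) le_rfl ?_
    · simp [RamState.reg_set]
    · simp [RamState.reg_set, h20]
    · simp [RamState.reg_set, h21]
    · simp [RamState.reg_set]
    · simp [RamState.reg_set, h33]
    rintro s ⟨a1, a2, a3⟩
    refine ⟨_, rfl, a1, ?_, ?_, ?_, ?_, ?_, ?_⟩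
    · rw [gapBound, if_pos hl]
      omega
    all_goals
      rw [a3 _ (by norm_num) (by simp)]
      simp [RamState.reg_set, h20, h33]
  · intro h0
    have hl : ¬ IsLarge M T.length := by
      intro h
      rw [lcpBits, if_pos h] at h0
      exact packedWord_true_ne_zero hw _ h0
    -- nothing is stored: the lower bound is `0`
    refine .mono (.nil ⟨0, ?_, Nat.zero_le _, ?_, ?_, ?_, ?_, ?_, ?_⟩) (by omega) fun _ h => h
    all_goals try simp [RamState.reg_set, h20, h33]
    rw [gapBound, if_neg hl]
    omega
  -- the certain match length is `y - (q - 1)`, truncated at zero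
  rintro s ⟨y, g19, hy1, hy2, g20, g22, g23, g24, g33⟩
  refine .op (if q - 1 < y then 1 else 0) ?_ <| .const (by omega) <|
    .cons' (M := (gapBound M T.length + 1) * (2 * tC + 14) + 4) (Q' := fun s =>
      s.reg 0 = y - (q - 1) ∧ s.reg 20 = T.length ∧ s.reg 22 = p ∧ s.reg 23 = q ∧
      s.reg 24 = q - 1 ∧ s.reg 33 = 1)
      (.ite (K := 2) ?_ ?_) (by omega) ?_
  · rw [g24, g19]; exact WordOp.eval_lt hw
  · intro _
    refine .op (y - (q - 1)) ?_ <| .nil ⟨?_, ?_, ?_, ?_, ?_, ?_⟩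
    all_goals simp only [RamState.reg_set, g19, g20, g22, g23, g24, g33, reduceIte,
      Nat.reduceEqDiff]
    rename_i hne
    have : q - 1 < y := by
      by_contra h
      simp [RamState.reg_set, h] at hne
    exact WordOp.eval_sub (by omega) (by omega)
  · intro h
    have : ¬ q - 1 < y := by
      intro h'
      simp [RamState.reg_set, h'] at h
    refine .mono (.nil ⟨?_, ?_, ?_, ?_, ?_, ?_⟩) (by omega) fun _ h => h
    all_goals simp only [RamState.reg_set, g19, g20, g22, g23, g24, g33, reduceIte,
      Nat.reduceEqDiff]
    omega
  rintro s2 ⟨k0, k20, k22, k23, k24, k33⟩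
  refine .op (p - 1) ?_ <| .op (T.length - (p - 1)) ?_ <| .op (T.length - (q - 1)) ?_ <|
    .cons' (M := 1) (runs_scan (g := gapBound M T.length) hchar hn hp1 hq1 hpn
      ⟨?_, ?_, ?_, ?_, ?_⟩ ?_ (l := y - (q - 1)) (by omega) (by omega)) le_rfl
      fun s h => .nil h
  all_goals simp only [RamState.reg_set, k0, k20, k22, k23, k24, k33, reduceIte,
      Nat.reduceEqDiff]
  · exact WordOp.eval_sub (by omega) hp1
  · exact WordOp.eval_sub hn (by omega)
  · exact WordOp.eval_sub hn (by omega)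

/-- The query program for entries of the LCP-array. -/
def lcpProg (M : ℕ) : Prog SAProc := block
  [.move 20 1, .move 21 2, .const 33 1, .op .lt 10 33 0,
   .ite 10 (neighbourQuery M) (block [.const 0 0])]

/-- The structure with the parameter `M`, for word widths given by `w`. -/
noncomputable def lcpRep (w : ℕ → ℕ) (M : ℕ) : LCPRep where
  bits T := lcpBits M (w T.length) T
  prog := lcpProg M

/-- The time bound for queries. -/
noncomputable def queryTime (M : ℕ) (tA tC : ℕ → ℕ) (n : ℕ) : ℕ :=
  2 * tA n + 6 * rootExp M n + 206 + (gapBound M n + 1) * (2 * tC n + 14)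

theorem hasAccessTime_lcpRep {w : ℕ → ℕ} (hw : ∀ n, n < 2 ^ w n) {K : Set (List ℕ)} {A : SARep}
    {tA tC : ℕ → ℕ} (hA : A.IsCSA w K tA tC) {M : ℕ} (hM : 0 < M) :
    (lcpRep w M).HasAccessTime A w K (queryTime M tA tC) := by
  intro T hT i hi1 hin
  have hn := hw T.length
  have hw0 : 0 < w T.length := by
    rcases Nat.eq_zero_or_pos (w T.length) with h | h
    · rw [h] at hn; omega
    · exact h
  have hruns : Runs (w T.length) (lcpBits M (w T.length) T) (A.proc (w T.length) T) (lcpProg M)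
      (queryStart (w T.length) T.length i) (queryTime M tA tC T.length)
      fun s' => s'.reg 0 = lcpEntry T i := by
    refine .mono (.move <| .move <| .const (by omega) <| .op (if 1 < i then 1 else 0) ?_ <|
      .cons' (M := 1) (Q' := fun s' => s'.reg 0 = lcpEntry T i)
      (.ite ?_ ?_) le_rfl fun s h => .nil h)
      (show (2 * tA T.length + 6 * rootExp M T.length + 200 +
        (gapBound M T.length + 1) * (2 * tC T.length + 14)) + 1 + 1 + 4 ≤ _ by
        unfold queryTime; omega) fun _ h => h
    · simp only [RamState.reg_set, queryStart, reduceIte, Nat.reduceEqDiff]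
      exact WordOp.eval_lt hw0
    · intro h
      have hi : 1 < i := by
        by_contra h'
        simp [RamState.reg_set, h'] at h
      refine runs_neighbourQuery hM (fun j h1 h2 => (hA T hT j h1 h2).1)
        (fun j h1 h2 => (hA T hT j h1 h2).2) hn hi hin ?_ ?_ ?_ ?_
      all_goals simp [RamState.reg_set, queryStart]
    · intro h
      have hi : i ≤ 1 := by
        by_contra! h'
        simp [RamState.reg_set, h'] at h
      refine .mono (.const (by omega) <| .nil ?_) (by omega) fun _ h => h
      simp [RamState.reg_set, lcpEntry, hi]
  obtain ⟨k, hk, s', he, hq⟩ := hruns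
  exact ⟨k, hk, s', he, hq⟩

/-! ### Asymptotics of the size and of the query time -/

theorem tendsto_rootExp {M : ℕ} (hM : 0 < M) : Tendsto (rootExp M) atTop atTop := by
  refine tendsto_atTop.2 fun b => ?_
  filter_upwards [eventually_ge_atTop (2 ^ 2 ^ (M * b))] with n hn
  by_contra! h
  have h1 : 2 ^ 2 ^ (M * rootExp M n) ≤ 2 ^ 2 ^ (M * b) :=
    Nat.pow_le_pow_right two_pos (Nat.pow_le_pow_right two_pos (Nat.mul_le_mul_left _ h.le))
  have := lt_rootExp hM n
  omega

theorem eventually_one_le_logb : ∀ᶠ n : ℕ in atTop, 1 ≤ Real.logb 2 n := by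
  filter_upwards [eventually_ge_atTop 2] with n hn
  have : (2 : ℝ) ≤ n := by exact_mod_cast hn
  rw [Real.le_logb_iff_rpow_le one_lt_two (by linarith), Real.rpow_one]
  exact this

theorem rootExp_pow_le_logb {M n : ℕ} (hn : 0 < n) (ha : 0 < rootExp M n) :
    (2 : ℝ) ^ (M * (rootExp M n - 1)) ≤ Real.logb 2 n := by
  have h := le_of_lt_rootExp (M := M) (n := n) (i := rootExp M n - 1) (by omega)
  rw [Real.le_logb_iff_rpow_le one_lt_two (by exact_mod_cast hn)]
  have : ((2 ^ 2 ^ (M * (rootExp M n - 1)) : ℕ) : ℝ) ≤ n := by exact_mod_cast h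
  push_cast at this
  refine le_trans (le_of_eq ?_) this
  exact_mod_cast Real.rpow_natCast 2 (2 ^ (M * (rootExp M n - 1)))

theorem digitBound_isBigO {M : ℕ} (hM : 0 < M) :
    (fun n => (digitBound M n : ℝ)) =O[atTop] fun n : ℕ => Real.logb 2 n := by
  refine IsBigO.of_bound (2 ^ M) ?_
  filter_upwards [eventually_gt_atTop 0, (tendsto_rootExp hM).eventually_gt_atTop 0] with n hn ha
  have h := rootExp_pow_le_logb hn ha
  rw [Real.norm_of_nonneg (by positivity),
    Real.norm_of_nonneg ((by positivity : (0 : ℝ) ≤ _).trans h)]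
  have : (digitBound M n : ℝ) = 2 ^ M * 2 ^ (M * (rootExp M n - 1)) := by
    rw [digitBound, ← pow_add]
    push_cast
    congr 1
    obtain ⟨b, hb⟩ := Nat.exists_eq_add_of_le' ha
    rw [hb, Nat.add_sub_cancel]
    ring
  rw [this]
  gcongr

theorem digitBound_pow_isLittleO {M : ℕ} (hM : 0 < M) (m : ℕ) :
    (fun n => (digitBound M n : ℝ) ^ m) =o[atTop] fun n : ℕ => (n : ℝ) := by
  refine ((digitBound_isBigO hM).pow m).trans_isLittleO ?_
  have h : (fun n : ℕ => Real.logb 2 n ^ m) =O[atTop] fun n : ℕ => Real.log n ^ m :=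
    IsBigO.pow (IsBigO.of_bound (Real.log 2)⁻¹ (Eventually.of_forall fun n => by
      rw [Real.logb, norm_div, div_eq_inv_mul,
        Real.norm_of_nonneg (Real.log_nonneg one_le_two)])) m
  exact h.trans_isLittleO
    (Real.isLittleO_pow_log_id_atTop.comp_tendsto tendsto_natCast_atTop_atTop)

theorem levelSize_le (f n s : ℕ) (hs : 0 < s) :
    (levelSize f n s : ℝ) ≤ (2 * f + 1) / s * n + (f + 1 + f * s) := by
  have hs' : (0 : ℝ) < s := by exact_mod_cast hs
  have h1 : ((n / s : ℕ) : ℝ) ≤ n / s := Nat.cast_div_le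
  have h2 : ((n / (s * s) : ℕ) : ℝ) ≤ n / (s * s) := by
    have := @Nat.cast_div_le ℝ _ _ _ n (s * s)
    push_cast at this
    exact this
  have h3 : ((n / (s * s) : ℕ) : ℝ) * s ≤ n / s := by
    calc _ ≤ (n / (s * s) : ℝ) * s := by gcongr
      _ = n / s := by field_simp
  unfold levelSize
  push_cast
  have hf : (0 : ℝ) ≤ f := by positivity
  have e1 := mul_le_mul_of_nonneg_left h1 hf
  have e3 := mul_le_mul_of_nonneg_left h3 hf
  have : (2 * f + 1) / s * n = f * (n / s) + n / s + f * (n / s : ℝ) := by ring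
  rw [this]
  linarith

/-- The term `3 / 2 ^ a ≥ 3 / X` comes from the upper level, the next one from the lower level with
its entries of `O(log log n)` bits. -/
theorem totalSize_le {M : ℕ} (hM : 0 < M) (n : ℕ) :
    (totalSize M n : ℝ) ≤ (3 / 2 ^ rootExp M n + (8 * M * rootExp M n + 1) / 2 ^ rootExp M n) * n +
      6 * digitBound M n ^ 5 := by
  set a := rootExp M n with ha
  have hkX : (2 : ℝ) ^ a ≤ digitBound M n := by
    rw [digitBound]
    push_cast
    exact pow_le_pow_right₀ one_le_two (Nat.le_mul_of_pos_left _ hM)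
  have hX1 : (1 : ℝ) ≤ digitBound M n := (one_le_pow₀ one_le_two).trans hkX
  have hc : ((4 * M * a : ℕ) : ℝ) + 1 ≤ (digitBound M n : ℝ) ^ 4 := by
    have : 4 * M * a + 1 ≤ digitBound M n ^ 4 := by
      rw [digitBound, ← pow_mul, ← ha, show M * a * 4 = 4 * M * a by ring]
      exact Nat.lt_two_pow_self
    exact_mod_cast this
  have hX0 : 0 < digitBound M n := by rw [digitBound]; positivity
  have h1 := levelSize_le (digitBound M n) n (digitBound M n * digitBound M n) (by positivity)
  have h2 := levelSize_le (4 * M * a) n (2 ^ a) (by positivity)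
  set X : ℝ := (digitBound M n : ℝ) with hX
  have g1 : (2 * X + 1) / (X * X) ≤ 3 / 2 ^ a := by
    calc (2 * X + 1) / (X * X) ≤ (3 * X) / (X * X) := by gcongr; linarith
      _ = 3 / X := by field_simp
      _ ≤ 3 / 2 ^ a := by gcongr
  have g1' := mul_le_mul_of_nonneg_right g1 (Nat.cast_nonneg n : (0 : ℝ) ≤ n)
  have p1 : X ≤ X ^ 5 := le_self_pow₀ hX1 (by norm_num)
  have p3 : X * (X * X) ≤ X ^ 5 := by
    rw [← pow_two, ← pow_succ']
    exact pow_le_pow_right₀ hX1 (by norm_num)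
  have p4 : X ^ 4 ≤ X ^ 5 := pow_le_pow_right₀ hX1 (by norm_num)
  have p5 : ((4 * M * a : ℕ) : ℝ) * 2 ^ a ≤ X ^ 5 - 1 := by
    have := mul_le_mul hc hkX (by positivity) (by positivity)
    have h2a : (1 : ℝ) ≤ 2 ^ a := one_le_pow₀ one_le_two
    rw [← pow_succ, add_mul, one_mul] at this
    exact le_sub_iff_add_le.2 ((add_le_add le_rfl h2a).trans this)
  rw [totalSize, ← ha]
  push_cast at h1 h2 hc p5 ⊢
  have : (8 * M * a + 1 : ℝ) = 2 * (4 * M * a) + 1 := by ring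
  rw [this]
  linarith

theorem totalSize_isLittleO {M : ℕ} (hM : 0 < M) :
    (fun n => (totalSize M n : ℝ)) =o[atTop] fun n : ℕ => (n : ℝ) := by
  have hpow : ∀ m : ℕ, Tendsto (fun a : ℕ => (a : ℝ) ^ m * (1 / 2) ^ a) atTop (nhds 0) := fun m =>
    tendsto_pow_const_mul_const_pow_of_abs_lt_one m (by rw [abs_of_pos] <;> norm_num)
  have hg : Tendsto (fun a : ℕ => (3 / 2 ^ a + (8 * M * a + 1) / 2 ^ a : ℝ)) atTop (nhds 0) := by
    have := ((hpow 0).const_mul 4).add ((hpow 1).const_mul (8 * M : ℝ))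
    simp only [mul_zero, add_zero] at this
    refine this.congr fun a => ?_
    rw [one_div, inv_pow]
    field_simp
    ring
  have hg' := (isLittleO_one_iff ℝ).2 (hg.comp (tendsto_rootExp hM))
  have h1 := hg'.mul_isBigO (isBigO_refl (fun n : ℕ => (n : ℝ)) atTop)
  simp only [one_mul, Function.comp_apply] at h1
  have h2 := (digitBound_pow_isLittleO hM 5).const_mul_left 6
  refine (IsBigO.of_bound 1 (Eventually.of_forall fun n => ?_)).trans_isLittleO (h1.add h2)
  rw [one_mul, Real.norm_of_nonneg (by positivity)]
  exact (totalSize_le hM n).trans (Real.le_norm_self _)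

theorem eventually_isLarge {M : ℕ} (hM : 0 < M) : ∀ᶠ n in atTop, IsLarge M n := by
  have h1 := (totalSize_isLittleO hM).bound one_pos
  have h2 := (digitBound_pow_isLittleO hM 4).bound one_pos
  filter_upwards [h1, h2, eventually_ge_atTop 2, eventually_ge_atTop (4 * M)] with n h1 h2 h3 h4
  simp only [one_mul, norm_pow, Real.norm_natCast] at h1 h2
  refine ⟨h3, h4, ?_, by exact_mod_cast h1⟩
  have : digitBound M n ^ 4 ≤ n := by exact_mod_cast h2
  rwa [digitBound, ← pow_mul, show M * rootExp M n * 4 = 4 * M * rootExp M n by ring] at this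

/-- The error of the lower level, for blocks of `2 ^ a` positions. -/
theorem rootExp_sq_isBigO {M : ℕ} (hM : 0 < M) {δ : ℝ} (hδ : 2 / M ≤ δ) :
    (fun n => ((2 ^ rootExp M n * 2 ^ rootExp M n : ℕ) : ℝ)) =O[atTop]
      fun n : ℕ => Real.logb 2 n ^ δ := by
  -- minimality of `a` bounds `2 ^ (a - 1)`, hence the constant `4`
  refine IsBigO.of_bound 4 ?_
  filter_upwards [eventually_gt_atTop 0, (tendsto_rootExp hM).eventually_gt_atTop 0,
    eventually_one_le_logb] with n hn ha hL
  have h := rootExp_pow_le_logb hn ha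
  have hM' : (0 : ℝ) < M := by exact_mod_cast hM
  rw [Real.norm_of_nonneg (by positivity), Real.norm_of_nonneg (by positivity)]
  obtain ⟨b, hb⟩ := Nat.exists_eq_add_of_le' ha
  rw [hb] at h ⊢
  rw [Nat.add_sub_cancel] at h
  have h2 : (2 : ℝ) ^ b * 2 ^ b ≤ Real.logb 2 n ^ (2 / M : ℝ) := by
    have := Real.rpow_le_rpow (by positivity) h (by positivity : (0 : ℝ) ≤ 2 / M)
    refine le_trans (le_of_eq ?_) this
    rw [← Real.rpow_natCast 2 (M * b), ← Real.rpow_mul two_pos.le]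
    push_cast
    rw [show (M * b * (2 / M) : ℝ) = ((b + b : ℕ) : ℝ) by push_cast; field_simp; ring,
      Real.rpow_natCast, pow_add]
  have h3 := Real.rpow_le_rpow_of_exponent_le hL hδ
  push_cast
  rw [pow_succ]
  linarith

theorem queryTime_isBigO {M : ℕ} (hM : 0 < M) {ε δ : ℝ} (hε : 0 < ε) (hδ0 : 0 < δ)
    (hδ : 2 / M ≤ δ) {tA tC : ℕ → ℕ}
    (htA : (fun n => (tA n : ℝ)) =O[atTop] fun n : ℕ => Real.logb 2 n ^ ε)
    (htC : (fun n => (tC n : ℝ)) =O[atTop] fun n => (tA n : ℝ)) :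
    (fun n => (queryTime M tA tC n : ℝ)) =O[atTop] fun n : ℕ => Real.logb 2 n ^ (ε + δ) := by
  have hone : ∀ {r : ℝ}, 0 ≤ r → ∀ c : ℝ,
      (fun _ : ℕ => c) =O[atTop] fun n : ℕ => Real.logb 2 n ^ r := by
    intro r hr c
    refine IsBigO.of_bound |c| ?_
    filter_upwards [eventually_one_le_logb] with n hn
    have h1 := Real.one_le_rpow hn hr
    rw [Real.norm_eq_abs, Real.norm_of_nonneg (by linarith)]
    exact le_mul_of_one_le_right (abs_nonneg c) h1
  have hexp : ∀ {r r' : ℝ}, r ≤ r' →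
      (fun n : ℕ => Real.logb 2 n ^ r) =O[atTop] fun n : ℕ => Real.logb 2 n ^ r' := by
    intro r r' h
    refine IsBigO.of_bound 1 ?_
    filter_upwards [eventually_one_le_logb] with n hn
    rw [one_mul, Real.norm_of_nonneg (by positivity), Real.norm_of_nonneg (by positivity)]
    exact Real.rpow_le_rpow_of_exponent_le hn h
  have hk := rootExp_sq_isBigO hM hδ
  have ha : (fun n => (rootExp M n : ℝ)) =O[atTop] fun n : ℕ => Real.logb 2 n ^ δ := by
    refine (IsBigO.of_bound 1 (Eventually.of_forall fun n => ?_)).trans hk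
    rw [one_mul, Real.norm_natCast, Real.norm_natCast]
    have h1 : rootExp M n < 2 ^ rootExp M n := Nat.lt_two_pow_self
    have h2 : 2 ^ rootExp M n ≤ 2 ^ rootExp M n * 2 ^ rootExp M n :=
      Nat.le_mul_of_pos_left _ (by positivity)
    exact_mod_cast h1.le.trans h2
  have hgap : (fun n => (gapBound M n : ℝ)) =O[atTop] fun n : ℕ => Real.logb 2 n ^ δ := by
    refine hk.congr' ?_ EventuallyEq.rfl
    filter_upwards [eventually_isLarge hM] with n hn
    rw [gapBound, if_pos hn]
  have hscan := (hgap.add (hone hδ0.le 1)).mul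
    (((htC.trans htA).const_mul_left 2).add (hone hε.le 14))
  have hmul : (fun n : ℕ => Real.logb 2 n ^ δ * Real.logb 2 n ^ ε) =ᶠ[atTop]
      fun n : ℕ => Real.logb 2 n ^ (ε + δ) := by
    filter_upwards [eventually_one_le_logb] with n hn
    rw [add_comm, Real.rpow_add (by linarith)]
  have h := ((((htA.const_mul_left 2).trans (hexp (show ε ≤ ε + δ by linarith))).add
    ((ha.const_mul_left 6).trans (hexp (show δ ≤ ε + δ by linarith)))).add
    (hone (show 0 ≤ ε + δ by linarith) 206)).add (hscan.congr' EventuallyEq.rfl hmul)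
  refine h.congr_left fun n => ?_
  simp [queryTime]

theorem mainTheorem3
    (w : ℕ → ℕ) (hw : ∀ n, n < 2 ^ w n)
    (K : Set (List ℕ)) (A : SARep) (tA tC : ℕ → ℕ) (hA : A.IsCSA w K tA tC)
    (ε : ℝ) (hε : 0 < ε)
    (htA : (fun n => (tA n : ℝ)) =O[atTop] fun n : ℕ => Real.logb 2 n ^ ε)
    (htC : (fun n => (tC n : ℝ)) =O[atTop] fun n => (tA n : ℝ))
    (δ : ℝ) (hδ : 0 < δ) (hδ1 : δ ≤ 1) :
    ∃ (L : LCPRep) (b t : ℕ → ℕ),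
      (∀ T ∈ K, (L.bits T).length ≤ b T.length) ∧
      (fun n => (b n : ℝ)) =o[atTop] (fun n : ℕ => (n : ℝ)) ∧
      L.HasAccessTime A w K t ∧
      (fun n => (t n : ℝ)) =O[atTop] fun n : ℕ => Real.logb 2 n ^ (ε + δ) := by
  -- blocks of `2 ^ a` positions have gaps of up to `4 ^ a`, so `2 ^ a` must be `O(log ^ (δ / 2))`
  have hM : 0 < ⌈2 / δ⌉₊ := Nat.ceil_pos.2 (by positivity)
  have hMδ : 2 / (⌈2 / δ⌉₊ : ℝ) ≤ δ := by
    rw [div_le_iff₀ (by exact_mod_cast hM), mul_comm, ← div_le_iff₀ hδ]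
    exact Nat.le_ceil _
  exact ⟨lcpRep w ⌈2 / δ⌉₊, totalSize ⌈2 / δ⌉₊, queryTime ⌈2 / δ⌉₊ tA tC,
    fun T _ => length_lcpBits_le _ _ T, totalSize_isLittleO hM, hasAccessTime_lcpRep hw hA hM,
    queryTime_isBigO hM hε hδ hMδ htA htC⟩
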